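/- Let $Q\in C^2(\mathbb R^2)$ be the positive radial solution in $H^1(\mathbb R^2)$ of $-\Delta Q+Q-Q^3=0$. There is a constant $\alpha_0>0$ such that both statements below hold. Consider pairs $(u,\vec x)$ as follows. The path $\vec x=(x_1,x_2):[0,\infty)\to\mathbb R^2$ is $C^1$, $x_1$ is increasing, and $$x_1(t_0)-x_1(t)\ge \tfrac34 (t_0-t)\qquad\text{whenever } 0\le t\le t_0.$$ The real-valued function $u\in C([0,\infty),H^1(\mathbb R^2))$ solves, in the sense of distributions, $u_t+\partial_{x_1}(\Delta u+u^3)=0$ for $t>0$, and for some $0<\alpha<\alpha_0$ $$\|u(t,\cdot+\vec x(t))-Q\|_{H^1(\mathbb R^2)}\le\alpha\qquad\text{for all } t\ge 0 .$$ Here $\|f\|_{H^1}^2=\|f\|_{L^2}^2+\|\nabla f\|_{L^2}^2$. For $M\ge4$ put $\psi(s)=\frac2\pi\arctan(e^{s/M})$ and $$I_{x_0,t_0}(t)=\int_{\mathbb R^2}u^2(t,x)\,\psi\big(x_1-x_1(t_0)+\tfrac12(t_0-t)-x_0\big)\,dx .$$ (1) (Almost monotonicity.) For every $M\ge 4$ there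 is $\theta=\theta(M)>0$ such that for all such pairs, all $x_0>0$ and all $0\le t\le t_0$, $$I_{x_0,t_0}(t_0)-I_{x_0,t_0}(t)\le\theta\,e^{-x_0/M}.$$ (2) (Exponential decay on the right.) For all $c,\delta>0$ and $M\ge\max\{4,2/\delta\}$ there is $C=C(M,\delta,c)>0$ such that, for all such pairs with moreover $x_1(t)\ge\frac12t$ and $x_2(t)=0$ for all $t\ge0$ and $$\int_{\mathbb R}|u(0,x_1,x_2)|^2\,dx_2\le c\,e^{-\delta|x_1|}\qquad\text{for almost every } x_1\in\mathbb R,$$ one has, for all $t\ge0$ and $x_0>0$, $$\int_{\mathbb R}\int_{x_1>x_0}u^2(t,x_1+x_1(t),x_2)\,dx_1dx_2\le C\,e^{-x_0/M}.$$ -/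

import Mathlib

open MeasureTheory Set
open scoped ContDiff Laplacian

namespace ZK

/-- The Euclidean plane; a point `x` has coordinates `x 0` (that is, `x₁`) and `x 1` (that is, `x₂`). -/
abbrev Plane := EuclideanSpace ℝ (Fin 2)

/-- The classical partial derivative in the `i`-th coordinate. -/
noncomputable def partialD (i : Fin 2) (φ : Plane → ℝ) (x : Plane) : ℝ :=
  fderiv ℝ φ x (EuclideanSpace.single i 1)

/-- Smooth compactly supported test functions on the plane. -/
def IsTest (φ : Plane → ℝ) : Prop := ContDiff ℝ ∞ φ ∧ HasCompactSupport φ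

theorem IsTest.memLp {φ : Plane → ℝ} (h : IsTest φ) : MemLp φ 2 volume :=
  h.1.continuous.memLp_of_hasCompactSupport h.2

theorem IsTest.memLp_partialD {φ : Plane → ℝ} (h : IsTest φ) (i : Fin 2) :
    MemLp (partialD i φ) 2 volume := by
  have hc : Continuous (partialD i φ) :=
    (h.1.continuous_fderiv (by simp)).clm_apply continuous_const
  exact hc.memLp_of_hasCompactSupport (h.2.fderiv_apply (𝕜 := ℝ) _)

/-- `g` is the weak gradient of `f`. It is only used for square integrable `f` and `g`. -/
def IsWeakGradient (f : Plane → ℝ) (g : Plane → Plane) : Prop :=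
  ∀ φ : Plane → ℝ, IsTest φ → ∀ i : Fin 2,
    ∫ x, f x * partialD i φ x = -∫ x, g x i * φ x

theorem memLp_coord (g : Lp Plane 2 (volume : Measure Plane)) (i : Fin 2) :
    MemLp (fun x => g x i) 2 volume :=
  (EuclideanSpace.proj (𝕜 := ℝ) i).comp_memLp' (Lp.memLp g)

/-- The real Sobolev space `H¹(ℝ²)`: the pairs formed by a function of `L²` and its weak gradient,
which is required to lie in `L²`. Its norm is `(‖f‖_{L²}² + ‖∇f‖_{L²}²)^{1/2}`, and the weak gradient
is determined by the function. -/
noncomputable def H1 : Submodule ℝ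
    (WithLp 2 (Lp ℝ 2 (volume : Measure Plane) × Lp Plane 2 (volume : Measure Plane))) where
  carrier := {p | IsWeakGradient p.fst p.snd}
  zero_mem' := by
    intro φ _ i
    have h1 : ∀ᵐ x, (0 : Lp ℝ 2 (volume : Measure Plane)) x * partialD i φ x = 0 := by
      filter_upwards [Lp.coeFn_zero ℝ 2 (volume : Measure Plane)] with x hx
      rw [hx, Pi.zero_apply, zero_mul]
    have h2 : ∀ᵐ x, (0 : Lp Plane 2 (volume : Measure Plane)) x i * φ x = 0 := by
      filter_upwards [Lp.coeFn_zero Plane 2 (volume : Measure Plane)] with x hx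
      rw [hx, Pi.zero_apply, PiLp.zero_apply, zero_mul]
    change ∫ x, (0 : Lp ℝ 2 (volume : Measure Plane)) x * partialD i φ x
      = -∫ x, (0 : Lp Plane 2 (volume : Measure Plane)) x i * φ x
    rw [integral_congr_ae h1, integral_congr_ae h2]
    simp
  add_mem' := by
    intro p q hp hq φ hφ i
    have h1 : ∀ᵐ x, (p.fst + q.fst) x * partialD i φ x
        = p.fst x * partialD i φ x + q.fst x * partialD i φ x := by
      filter_upwards [Lp.coeFn_add p.fst q.fst] with x hx
      rw [hx, Pi.add_apply, add_mul]
    have h2 : ∀ᵐ x, (p.snd + q.snd) x i * φ x = p.snd x i * φ x + q.snd x i * φ x := by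
      filter_upwards [Lp.coeFn_add p.snd q.snd] with x hx
      rw [hx, Pi.add_apply, PiLp.add_apply, add_mul]
    change ∫ x, (p.fst + q.fst) x * partialD i φ x = -∫ x, (p.snd + q.snd) x i * φ x
    rw [integral_congr_ae h1, integral_congr_ae h2, integral_add, integral_add, hp φ hφ i,
      hq φ hφ i]
    · ring
    · exact (memLp_coord p.snd i).integrable_mul hφ.memLp
    · exact (memLp_coord q.snd i).integrable_mul hφ.memLp
    · exact (Lp.memLp p.fst).integrable_mul (hφ.memLp_partialD i)
    · exact (Lp.memLp q.fst).integrable_mul (hφ.memLp_partialD i)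
  smul_mem' := by
    intro c p hp φ hφ i
    have h1 : ∀ᵐ x, (c • p.fst) x * partialD i φ x = c * (p.fst x * partialD i φ x) := by
      filter_upwards [Lp.coeFn_smul c p.fst] with x hx
      simp [hx, mul_assoc]
    have h2 : ∀ᵐ x, (c • p.snd) x i * φ x = c * (p.snd x i * φ x) := by
      filter_upwards [Lp.coeFn_smul c p.snd] with x hx
      simp [hx, mul_assoc]
    change ∫ x, (c • p.fst) x * partialD i φ x = -∫ x, (c • p.snd) x i * φ x
    rw [integral_congr_ae h1, integral_congr_ae h2, integral_const_mul, integral_const_mul,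
      hp φ hφ i]
    ring

/-- An element of `H¹` as a function on the plane (a representative of its `L²` class). -/
noncomputable instance : CoeFun H1 (fun _ => Plane → ℝ) := ⟨fun f => f.1.fst⟩

/-- The ground state: a positive radial `H¹` solution of `-ΔQ + Q - Q³ = 0` on the plane. -/
structure IsGroundState (Q : Plane → ℝ) : Prop where
  contDiff : ContDiff ℝ 2 Q
  pos : ∀ x, 0 < Q x
  radial : ∀ x y, ‖x‖ = ‖y‖ → Q x = Q y
  mem_H1 : ∃ v : H1, v =ᵐ[volume] Q
  equation : ∀ x, -(Δ Q) x + Q x - Q x ^ 3 = 0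

/-- `u ∈ C([0,∞), H¹(ℝ²))` solves `u_t + ∂_{x₁}(Δu + u³) = 0` for `t > 0` in the sense of
distributions: the `x`-derivatives fall on the test functions. -/
structure IsSolution (u : ℝ → H1) : Prop where
  continuousOn : ContinuousOn u (Ici 0)
  equation : ∀ φ : Plane → ℝ, IsTest φ → ∀ t > 0,
    HasDerivAt (fun s => ∫ x, u s x * φ x)
      (∫ x, (u t x * partialD 0 (Δ φ) x + u t x ^ 3 * partialD 0 φ x)) t

/-- The function `x ↦ w (x + y) - Q x` lies in `H¹` and its `H¹` norm is at most `α`. -/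
def IsCloseAt (Q : Plane → ℝ) (w : H1) (y : Plane) (α : ℝ) : Prop :=
  ∃ v : H1, (∀ᵐ x, v x = w (x + y) - Q x) ∧ ‖v‖ ≤ α

/-- A `C¹` path in the plane whose first coordinate increases, at average speed at least `3/4` on
each time interval. -/
structure IsRightMoving (X : ℝ → Plane) : Prop where
  contDiffOn : ContDiffOn ℝ 1 X (Ici 0)
  monotoneOn : MonotoneOn (fun t => X t 0) (Ici 0)
  speed : ∀ t₀ t : ℝ, 0 ≤ t → t ≤ t₀ → 3 / 4 * (t₀ - t) ≤ X t₀ 0 - X t 0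

/-- The weight `ψ(s) = (2/π) arctan(e^{s/M})`. -/
noncomputable def weight (M s : ℝ) : ℝ := 2 / Real.pi * Real.arctan (Real.exp (s / M))

/-- The localized mass
`I_{x₀,t₀}(t) = ∫ u²(t,x) ψ(x₁ - x₁(t₀) + (t₀ - t)/2 - x₀) dx`, along the path `X = (x₁, x₂)`. -/
noncomputable def localizedMass (M : ℝ) (u : ℝ → H1) (X : ℝ → Plane) (x₀ t₀ t : ℝ) : ℝ :=
  ∫ x : Plane, u t x ^ 2 * weight M (x 0 - X t₀ 0 + 1 / 2 * (t₀ - t) - x₀)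

end ZK

namespace ZK

open Filter Topology ENNReal

/-! The weight in `localizedMass` has its transition at $x_1(t_0)-\frac12(t_0-s)+x_0$ at time $s$:
it travels at speed $\frac12$, while the wave has average speed at least $\frac34$. Going back from
$t_0$ to $s$, the wave therefore lies to the left of the transition by at least
$x_0+\frac14(t_0-s)$.

For smooth solutions, integration by parts gives $$\frac{d}{ds}\int
u^2\psi=-\int(3u_{x_1}^2+u_{x_2}^2)\psi'+\int u^2\psi'''+\frac32\int u^4\psi'-\frac12\int
u^2\psi'.$$ The last term comes from the motion of the weight. Since $M\ge4$,
$|\psi'''|\le\frac1{16}\psi'$ (`abs_arctanWeight_three_le`), so only the quartic term can spoil the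
sign. Write $u=v+p$, with $p$ a translate of a fixed test function close to $Q$ in $H^1$ and $v$
small in $H^1$. A weighted Gagliardo-Nirenberg inequality (`exists_weighted_gagliardoNirenberg`)
bounds $\int v^4\psi'$ by a small multiple of $\int(v^2+|\nabla v|^2)\psi'$, which the negative
terms absorb up to terms in $p$. What remains (`exists_massRate_le`) is an integral over the support
of $p$, where $\psi'\lesssim e^{-(x_0+(t_0-s)/4)/M}$; integrating in $s$ gives (1). Compact support
of the test function takes the place of the decay of $Q$.

As $u(s)$ is only in $H^1$, the identity is first proved for $k*u$: testing the equation with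
$y\mapsto k(x-y)$ gives its pointwise time derivative (`IsSolution.mollified_mass`). The
mollification is removed by dominated convergence in time (`IsSolution.localized_mass_sub_le`).

For (2), (1) is applied between $0$ and $t$. The mass at time $t$ dominates half of the mass on the
right because $\psi\ge\frac12$ on $[0,\infty)$; the mass at time $0$ is controlled by $\psi(s)\le
e^{s/M}$ and the decay of the initial datum. -/

theorem eLpNorm_two_sq {α E : Type*} [MeasurableSpace α] [NormedAddCommGroup E] (μ : Measure α)
    (f : α → E) : eLpNorm f 2 μ ^ 2 = ∫⁻ x, ‖f x‖ₑ ^ 2 ∂μ := by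
  have h := eLpNorm_nnreal_pow_eq_lintegral (μ := μ) (f := f) (p := 2) (by norm_num)
  simpa using h

/-- The Cauchy-Schwarz inequality for the Lebesgue integral. -/
theorem lintegral_mul_sq_le {α : Type*} [MeasurableSpace α] {μ : Measure α} {a b : α → ℝ≥0∞}
    (ha : AEMeasurable a μ) (hb : AEMeasurable b μ) :
    (∫⁻ x, a x * b x ∂μ) ^ 2 ≤ (∫⁻ x, a x ^ 2 ∂μ) * ∫⁻ x, b x ^ 2 ∂μ := by
  have h := ENNReal.lintegral_mul_le_Lp_mul_Lq μ Real.HolderConjugate.two_two ha hb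
  calc (∫⁻ x, a x * b x ∂μ) ^ 2
      ≤ ((∫⁻ x, a x ^ (2 : ℝ) ∂μ) ^ (1 / 2 : ℝ) * (∫⁻ x, b x ^ (2 : ℝ) ∂μ) ^ (1 / 2 : ℝ)) ^ 2 := by
        gcongr; exact h
    _ = _ := by
        rw [mul_pow, ← ENNReal.rpow_natCast, ← ENNReal.rpow_mul, ← ENNReal.rpow_natCast,
          ← ENNReal.rpow_mul]
        simp

/-! ### Test functions and their derivatives. -/

theorem IsTest.isTest_partialD {φ : Plane → ℝ} (h : IsTest φ) (i : Fin 2) : IsTest (partialD i φ) :=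
  ⟨(h.1.fderiv_right (m := ∞) (by simp)).clm_apply contDiff_const,
    h.2.fderiv_apply (𝕜 := ℝ) _⟩

theorem IsTest.differentiable {φ : Plane → ℝ} (h : IsTest φ) : Differentiable ℝ φ :=
  h.1.differentiable (by simp)

/-- A mollification at `x` is a pairing with this test function; this is how weak gradients and the
equation act on mollifications. -/
theorem IsTest.reflect {k : Plane → ℝ} (h : IsTest k) (x : Plane) : IsTest fun y => k (x - y) := by
  refine ⟨h.1.comp (contDiff_const.sub contDiff_id), ?_⟩
  exact h.2.comp_homeomorph (Homeomorph.subLeft x)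

theorem IsTest.translate {k : Plane → ℝ} (h : IsTest k) (x : Plane) : IsTest fun y => k (y + x) :=
  ⟨h.1.comp (contDiff_id.add contDiff_const), h.2.comp_homeomorph (Homeomorph.addRight x)⟩

theorem IsTest.mul {f g : Plane → ℝ} (hf : IsTest f) (hg : IsTest g) : IsTest fun x => f x * g x :=
  ⟨hf.1.mul hg.1, hf.2.mul_right⟩

theorem IsTest.pow {f : Plane → ℝ} (hf : IsTest f) {n : ℕ} (hn : n ≠ 0) :
    IsTest fun x => f x ^ n :=
  ⟨hf.1.pow n, hf.2.comp_left (g := fun y => y ^ n) (by simp [hn])⟩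

theorem partialD_reflect {k : Plane → ℝ} (hk : Differentiable ℝ k) (i : Fin 2) (x : Plane) :
    partialD i (fun y => k (x - y)) = fun y => -partialD i k (x - y) := by
  ext y
  have h : HasFDerivAt (fun y => k (x - y))
      ((fderiv ℝ k (x - y)).comp (-ContinuousLinearMap.id ℝ Plane)) y :=
    (hk (x - y)).hasFDerivAt.comp y ((hasFDerivAt_id y).const_sub x)
  simp [partialD, h.fderiv]

theorem partialD_comp_add (k : Plane → ℝ) (i : Fin 2) (x : Plane) :
    partialD i (fun y => k (y + x)) = fun y => partialD i k (y + x) := by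
  ext y
  simp [partialD, fderiv_comp_add_right]

theorem partialD_comm {φ : Plane → ℝ} (h : ContDiff ℝ ∞ φ) (i j : Fin 2) :
    partialD i (partialD j φ) = partialD j (partialD i φ) := by
  ext x
  have hd : DifferentiableAt ℝ (fderiv ℝ φ) x :=
    ((h.fderiv_right (m := ∞) (by simp)).differentiable (by simp)) x
  have key (v w : Plane) : fderiv ℝ (fun y => fderiv ℝ φ y v) x w =
      fderiv ℝ (fderiv ℝ φ) x w v := by
    rw [fderiv_clm_apply hd (differentiableAt_const v)]
    simp
  have hs : IsSymmSndFDerivAt ℝ φ x := h.contDiffAt.isSymmSndFDerivAt (by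
    simpa using WithTop.coe_le_coe.2 (le_top : (2 : ℕ∞) ≤ ⊤))
  change fderiv ℝ (fun y => fderiv ℝ φ y _) x _ = fderiv ℝ (fun y => fderiv ℝ φ y _) x _
  rw [key, key]
  exact hs.eq _ _

theorem laplacian_eq_sum_partialD {φ : Plane → ℝ} (h : ContDiff ℝ ∞ φ) :
    Δ φ = fun x => ∑ i, partialD i (partialD i φ) x := by
  rw [InnerProductSpace.laplacian_eq_iteratedFDeriv_orthonormalBasis φ
    (EuclideanSpace.basisFun (Fin 2) ℝ)]
  ext x
  refine Finset.sum_congr rfl fun i _ => ?_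
  have hd : DifferentiableAt ℝ (fderiv ℝ φ) x :=
    ((h.fderiv_right (m := ∞) (by simp)).differentiable (by simp)) x
  rw [iteratedFDeriv_two_apply]
  change _ = fderiv ℝ (fun y => fderiv ℝ φ y _) x _
  rw [fderiv_clm_apply hd (differentiableAt_const _)]
  simp

theorem hasLineDerivAt_partialD {φ : Plane → ℝ} (h : Differentiable ℝ φ) (i : Fin 2) (x : Plane) :
    HasLineDerivAt ℝ φ (partialD i φ x) x (EuclideanSpace.single i 1) :=
  (h x).hasFDerivAt.hasLineDerivAt _

/-- Integration by parts against the constant `1`. The later weighted identities apply it to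
products. -/
theorem integral_lineDeriv_eq_zero {f f' : Plane → ℝ} {v : Plane} (hf : Integrable f)
    (hf' : Integrable f') (h : ∀ x, HasLineDerivAt ℝ f (f' x) x v) : ∫ x, f' x = 0 := by
  have hB := integral_bilinear_hasLineDerivAt_right_eq_neg_left_of_integrable (μ := volume)
    (f := fun _ : Plane => (1 : ℝ)) (f' := fun _ => 0) (g := f) (g' := f') (v := v)
    (B := ContinuousLinearMap.mul ℝ ℝ) (by simp) (by simpa using hf') (by simpa using hf)
    (fun x _ => by simpa [HasLineDerivAt] using hasDerivAt_const (0 : ℝ) (1 : ℝ))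
    (fun x _ => h x)
  simpa using hB

/-! ### Mollification and Young's inequality. -/

/-- The convolution of `f` with the kernel `k`. -/
noncomputable def mollify (k f : Plane → ℝ) : Plane → ℝ :=
  convolution f k (ContinuousLinearMap.mul ℝ ℝ) volume

theorem mollify_apply (k f : Plane → ℝ) (x : Plane) : mollify k f x = ∫ y, f y * k (x - y) := rfl

theorem contDiff_mollify {k f : Plane → ℝ} (hk : IsTest k) (hf : LocallyIntegrable f) :
    ContDiff ℝ ∞ (mollify k f) :=
  hk.2.contDiff_convolution_right _ hf hk.1

theorem partialD_mollify {k f : Plane → ℝ} (hk : IsTest k) (hf : LocallyIntegrable f) (i : Fin 2) :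
    partialD i (mollify k f) = mollify (partialD i k) f := by
  ext x
  have h := hk.2.hasFDerivAt_convolution_right (ContinuousLinearMap.mul ℝ ℝ) hf
    (hk.1.of_le (by simp)) x
  rw [partialD, mollify, h.fderiv, convolution_precompR_apply _ hf (hk.2.fderiv ℝ)
    (hk.1.continuous_fderiv (by simp))]
  rfl

theorem hasLineDerivAt_mollify {k f : Plane → ℝ} (hk : IsTest k) (hf : LocallyIntegrable f)
    (i : Fin 2) (x : Plane) :
    HasLineDerivAt ℝ (mollify k f) (mollify (partialD i k) f x) x (EuclideanSpace.single i 1) := by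
  rw [← partialD_mollify hk hf]
  exact hasLineDerivAt_partialD ((contDiff_mollify hk hf).differentiable (by simp)) i x

/-- Young's inequality for the convolution of a square integrable function with an integrable
kernel. -/
theorem eLpNorm_mollify_le {k f : Plane → ℝ} (hk : IsTest k) (hf : MemLp f 2) :
    eLpNorm (mollify k f) 2 ≤ eLpNorm k 1 * eLpNorm f 2 := by
  set K := eLpNorm k 1 (volume : Measure Plane) with hK
  have hkm : Measurable k := hk.1.continuous.measurable
  have hfm := hf.1.aemeasurable
  have hkx (x : Plane) : ∫⁻ y, ‖k (x - y)‖ₑ = K := by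
    rw [hK, eLpNorm_one_eq_lintegral_enorm]
    exact lintegral_sub_left_eq_self (fun y => ‖k y‖ₑ) x
  have hky (y : Plane) : ∫⁻ x, ‖k (x - y)‖ₑ = K := by
    rw [hK, eLpNorm_one_eq_lintegral_enorm]
    exact lintegral_sub_right_eq_self (fun y => ‖k y‖ₑ) y
  -- Cauchy-Schwarz for the splitting $|k|^{1/2}\cdot(|f||k|^{1/2})$ extracts one factor $\|k\|_1$;
  -- Tonelli produces the other one in `hsw`.
  have hpt (x : Plane) : ‖mollify k f x‖ₑ ^ 2 ≤ K * ∫⁻ y, ‖f y‖ₑ ^ 2 * ‖k (x - y)‖ₑ := by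
    have hkxm : AEMeasurable (fun y => ‖k (x - y)‖ₑ) (volume : Measure Plane) :=
      (hkm.comp (measurable_const.sub measurable_id)).enorm.aemeasurable
    have hs (a : ℝ≥0∞) : (a ^ (1 / 2 : ℝ)) ^ 2 = a := by
      rw [← ENNReal.rpow_natCast, ← ENNReal.rpow_mul]; simp
    have h1 : ‖mollify k f x‖ₑ ≤ ∫⁻ y, ‖k (x - y)‖ₑ ^ (1 / 2 : ℝ)
        * (‖f y‖ₑ * ‖k (x - y)‖ₑ ^ (1 / 2 : ℝ)) := by
      rw [mollify_apply]
      refine (enorm_integral_le_lintegral_enorm _).trans_eq (lintegral_congr fun y => ?_)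
      rw [enorm_mul, mul_left_comm, ← sq, hs]
    calc ‖mollify k f x‖ₑ ^ 2 ≤ (∫⁻ y, ‖k (x - y)‖ₑ ^ (1 / 2 : ℝ)
        * (‖f y‖ₑ * ‖k (x - y)‖ₑ ^ (1 / 2 : ℝ))) ^ 2 := by gcongr
      _ ≤ (∫⁻ y, (‖k (x - y)‖ₑ ^ (1 / 2 : ℝ)) ^ 2)
          * ∫⁻ y, (‖f y‖ₑ * ‖k (x - y)‖ₑ ^ (1 / 2 : ℝ)) ^ 2 :=
        lintegral_mul_sq_le (hkxm.pow_const _) (hfm.enorm.mul (hkxm.pow_const _))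
      _ = _ := by simp_rw [mul_pow, hs, hkx]
  have hsw : ∫⁻ x, ∫⁻ y, ‖f y‖ₑ ^ 2 * ‖k (x - y)‖ₑ = K * ∫⁻ y, ‖f y‖ₑ ^ 2 := by
    rw [lintegral_lintegral_swap]
    · have (y : Plane) : ∫⁻ x, ‖f y‖ₑ ^ 2 * ‖k (x - y)‖ₑ = ‖f y‖ₑ ^ 2 * K := by
        rw [lintegral_const_mul' _ _ (by finiteness), hky]
      simp_rw [this]
      rw [lintegral_mul_const'' _ (hfm.enorm.pow_const _), mul_comm]
    · exact (hfm.enorm.pow_const 2).comp_snd.mul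
        ((hkm.comp (measurable_fst.sub measurable_snd)).enorm.aemeasurable)
  have h2 : eLpNorm (mollify k f) 2 ^ 2 ≤ (K * eLpNorm f 2) ^ 2 := by
    rw [eLpNorm_two_sq, mul_pow, eLpNorm_two_sq]
    calc ∫⁻ x, ‖mollify k f x‖ₑ ^ 2 ≤ ∫⁻ x, K * ∫⁻ y, ‖f y‖ₑ ^ 2 * ‖k (x - y)‖ₑ :=
          lintegral_mono hpt
      _ ≤ _ := by
        rw [lintegral_const_mul', hsw, sq, mul_assoc]
        rw [hK]
        exact (memLp_one_iff_integrable.2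
          (hk.1.continuous.integrable_of_hasCompactSupport hk.2)).eLpNorm_ne_top
  exact (ENNReal.pow_le_pow_left_iff two_ne_zero).1 h2

theorem memLp_mollify {k f : Plane → ℝ} (hk : IsTest k) (hf : MemLp f 2) :
    MemLp (mollify k f) 2 := by
  refine ⟨(contDiff_mollify hk
    (hf.locallyIntegrable (by norm_num))).continuous.aestronglyMeasurable, ?_⟩
  refine (eLpNorm_mollify_le hk hf).trans_lt (ENNReal.mul_lt_top ?_ hf.2)
  exact (memLp_one_iff_integrable.2
    (hk.1.continuous.integrable_of_hasCompactSupport hk.2)).2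

/-! ### Strong convergence in $L^2$ of the plane. -/

/-- Convergence of a sequence of functions in `L²` of the plane. -/
structure TendstoL2 (F : ℕ → Plane → ℝ) (f : Plane → ℝ) : Prop where
  memLp : ∀ n, MemLp (F n) 2
  memLp_lim : MemLp f 2
  tendsto : Tendsto (fun n => eLpNorm (F n - f) 2) atTop (𝓝 0)

theorem TendstoL2.of_sq {F : ℕ → Plane → ℝ} {f : Plane → ℝ} (hF : ∀ n, MemLp (F n) 2)
    (hf : MemLp f 2) (h : Tendsto (fun n => ∫⁻ x, ‖F n x - f x‖ₑ ^ 2) atTop (𝓝 0)) :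
    TendstoL2 F f := by
  refine ⟨hF, hf, ?_⟩
  have h' : Tendsto (fun n => (eLpNorm (F n - f) 2 ^ 2) ^ (1 / 2 : ℝ)) atTop (𝓝 0) := by
    simp_rw [eLpNorm_two_sq]
    simpa using h.ennrpow_const (1 / 2 : ℝ)
  refine h'.congr fun n => ?_
  rw [← ENNReal.rpow_natCast, ← ENNReal.rpow_mul]; simp

theorem TendstoL2.lintegral_sq {F : ℕ → Plane → ℝ} {f : Plane → ℝ} (h : TendstoL2 F f) :
    Tendsto (fun n => ∫⁻ x, ‖F n x - f x‖ₑ ^ 2) atTop (𝓝 0) := by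
  have := ((ENNReal.continuous_pow 2).tendsto 0).comp h.tendsto
  simpa [Function.comp_def, eLpNorm_two_sq] using this

theorem TendstoL2.of_dominated {F : ℕ → Plane → ℝ} {f b : Plane → ℝ} (hF : ∀ n, MemLp (F n) 2)
    (hf : MemLp f 2) (hb : MemLp b 2) (hFb : ∀ n x, |F n x - f x| ≤ b x)
    (h : ∀ x, Tendsto (fun n => F n x) atTop (𝓝 (f x))) : TendstoL2 F f := by
  refine .of_sq hF hf ?_
  have h0 : (0 : ℝ≥0∞) = ∫⁻ _ : Plane, 0 := by simp
  rw [h0]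
  refine tendsto_lintegral_of_dominated_convergence' (fun x => ‖b x‖ₑ ^ 2)
    (fun n => ((hF n).1.sub hf.1).aemeasurable.enorm.pow_const 2) (fun n => ?_) ?_ ?_
  · refine Eventually.of_forall fun x => ?_
    refine pow_le_pow_left' ?_ 2
    rw [Real.enorm_eq_ofReal_abs, Real.enorm_eq_ofReal_abs]
    exact ENNReal.ofReal_le_ofReal ((hFb n x).trans (le_abs_self _))
  · rw [← eLpNorm_two_sq]
    exact ENNReal.pow_ne_top hb.2.ne
  · refine Eventually.of_forall fun x => ?_
    have h1 : Tendsto (fun n => F n x - f x) atTop (𝓝 0) := by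
      simpa using (h x).sub_const (f x)
    have h2 := ((ENNReal.continuous_pow 2).tendsto 0).comp (by simpa using h1.enorm)
    simpa [Function.comp_def] using h2

theorem TendstoL2.const {f : Plane → ℝ} (hf : MemLp f 2) : TendstoL2 (fun _ => f) f :=
  ⟨fun _ => hf, hf, by simp⟩

theorem TendstoL2.add {F G : ℕ → Plane → ℝ} {f g : Plane → ℝ} (hF : TendstoL2 F f)
    (hG : TendstoL2 G g) : TendstoL2 (fun n x => F n x + G n x) (fun x => f x + g x) := by
  refine ⟨fun n => (hF.memLp n).add (hG.memLp n), hF.memLp_lim.add hG.memLp_lim, ?_⟩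
  refine tendsto_of_tendsto_of_tendsto_of_le_of_le tendsto_const_nhds
    (by simpa using hF.tendsto.add hG.tendsto) (fun _ => bot_le) fun n => ?_
  have : (fun x => F n x + G n x) - (fun x => f x + g x) = (F n - f) + (G n - g) := by
    ext x; simp; ring
  dsimp only
  rw [this]
  exact eLpNorm_add_le ((hF.memLp n).sub hF.memLp_lim).1 ((hG.memLp n).sub hG.memLp_lim).1
    (by norm_num)

theorem memLp_mul_bdd {f p : Plane → ℝ} {C : ℝ} (hf : MemLp f 2) (hp : AEStronglyMeasurable p)
    (hC : ∀ x, |p x| ≤ C) : MemLp (fun x => f x * p x) 2 := by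
  refine (hf.const_mul C).mono (hf.1.mul hp) (Eventually.of_forall fun x => ?_)
  have hC0 : 0 ≤ C := (abs_nonneg _).trans (hC x)
  simp only [norm_mul, Real.norm_eq_abs, abs_of_nonneg hC0]
  rw [mul_comm]
  gcongr
  exact hC x

/-- Split $F_nc_n-fd=(F_n-f)c_n+f(c_n-d)$: the uniform bound on $c_n$ handles the first term,
dominated convergence with majorant $2C|f|$ the second. -/
theorem TendstoL2.mul_seq {F c : ℕ → Plane → ℝ} {f d : Plane → ℝ} {C : ℝ} (hF : TendstoL2 F f)
    (hc : ∀ n, AEStronglyMeasurable (c n)) (hd : AEStronglyMeasurable d)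
    (hC : ∀ n x, |c n x| ≤ C) (hdC : ∀ x, |d x| ≤ C)
    (h : ∀ x, Tendsto (fun n => c n x) atTop (𝓝 (d x))) :
    TendstoL2 (fun n x => F n x * c n x) (fun x => f x * d x) := by
  have h1 : TendstoL2 (fun n x => f x * c n x) (fun x => f x * d x) := by
    refine .of_dominated (b := fun x => 2 * C * |f x|)
      (fun n => memLp_mul_bdd hF.memLp_lim (hc n) (hC n))
      (memLp_mul_bdd hF.memLp_lim hd hdC) (hF.memLp_lim.norm.const_mul _) (fun n x => ?_)
      fun x => (h x).const_mul _
    rw [← mul_sub, abs_mul, mul_comm]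
    gcongr
    have h1 := hC n x
    have h2 := hdC x
    rw [abs_le] at *
    constructor <;> linarith
  have h2 : TendstoL2 (fun n x => (F n x - f x) * c n x) (fun _ => 0) := by
    refine .of_sq (fun n => memLp_mul_bdd ((hF.memLp n).sub hF.memLp_lim) (hc n) (hC n))
        (by simp) ?_
    refine tendsto_of_tendsto_of_tendsto_of_le_of_le tendsto_const_nhds (h := fun n =>
      ENNReal.ofReal (C ^ 2) * ∫⁻ x, ‖F n x - f x‖ₑ ^ 2) ?_ (fun _ => bot_le) fun n => ?_
    · simpa using ENNReal.Tendsto.const_mul hF.lintegral_sq (Or.inr (by simp))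
    · dsimp only
      rw [← lintegral_const_mul' _ _ (by simp)]
      refine lintegral_mono fun x => ?_
      have hC0 : 0 ≤ C := (abs_nonneg _).trans (hC n x)
      rw [sub_zero, enorm_mul, mul_pow, mul_comm, ENNReal.ofReal_pow hC0]
      gcongr
      rw [Real.enorm_eq_ofReal_abs]
      exact ENNReal.ofReal_le_ofReal (hC n x)
  convert h1.add h2 using 3 <;> ring

theorem TendstoL2.mul_bdd {F : ℕ → Plane → ℝ} {f p : Plane → ℝ} {C : ℝ} (hF : TendstoL2 F f)
    (hp : AEStronglyMeasurable p) (hC : ∀ x, |p x| ≤ C) :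
    TendstoL2 (fun n x => F n x * p x) (fun x => f x * p x) :=
  hF.mul_seq (fun _ => hp) hp (fun _ => hC) hC fun _ => tendsto_const_nhds

theorem TendstoL2.integral_mul {F G : ℕ → Plane → ℝ} {f g : Plane → ℝ} (hF : TendstoL2 F f)
    (hG : TendstoL2 G g) :
    Tendsto (fun n => ∫ x, F n x * G n x) atTop (𝓝 (∫ x, f x * g x)) := by
  have key {a b : Plane → ℝ} (ha : MemLp a 2) (hb : MemLp b 2) :
      ∫ x, a x * b x = inner ℝ (hb.toLp b) (ha.toLp a) := by
    rw [L2.inner_def]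
    refine integral_congr_ae ?_
    filter_upwards [ha.coeFn_toLp, hb.coeFn_toLp] with x h1 h2
    simp [h1, h2]
  have hL {F : ℕ → Plane → ℝ} {f : Plane → ℝ} (hF : TendstoL2 F f) :
      Tendsto (fun n => (hF.memLp n).toLp (F n)) atTop (𝓝 (hF.memLp_lim.toLp f)) :=
    (Lp.tendsto_Lp_iff_tendsto_eLpNorm'' F hF.memLp f hF.memLp_lim).2 hF.tendsto
  rw [key hF.memLp_lim hG.memLp_lim]
  exact ((hL hG).inner (hL hF)).congr fun n => (key (hF.memLp n) (hG.memLp n)).symm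

theorem TendstoL2.integral_mul_mul {F G : ℕ → Plane → ℝ} {f g p : Plane → ℝ} {C : ℝ}
    (hF : TendstoL2 F f) (hG : TendstoL2 G g) (hp : AEStronglyMeasurable p)
    (hC : ∀ x, |p x| ≤ C) :
    Tendsto (fun n => ∫ x, F n x * G n x * p x) atTop (𝓝 (∫ x, f x * g x * p x)) := by
  simp_rw [mul_assoc]
  exact hF.integral_mul (hG.mul_bdd hp hC)

theorem TendstoL2.exists_subseq_ae {F : ℕ → Plane → ℝ} {f : Plane → ℝ} (hF : TendstoL2 F f) :
    ∃ s : ℕ → ℕ, StrictMono s ∧ ∀ᵐ x, Tendsto (fun n => F (s n) x) atTop (𝓝 (f x)) :=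
  (tendstoInMeasure_of_tendsto_eLpNorm (by norm_num) (fun n => (hF.memLp n).1) hF.memLp_lim.1
    hF.tendsto).exists_seq_tendsto_ae

/-! ### Approximate identities. -/

/-- A sequence of bump functions concentrating at the origin. -/
noncomputable def bumpSeq (n : ℕ) : ContDiffBump (0 : Plane) where
  rIn := 1 / (2 * (n + 1))
  rOut := 1 / (n + 1)
  rIn_pos := by positivity
  rIn_lt_rOut := by
    have : (0 : ℝ) < n + 1 := by positivity
    rw [div_lt_div_iff₀ (by positivity) this]
    linarith

/-- The associated mollifiers, of integral one. -/
noncomputable def molli (n : ℕ) : Plane → ℝ := (bumpSeq n).normed volume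

theorem isTest_molli (n : ℕ) : IsTest (molli n) :=
  ⟨(bumpSeq n).contDiff_normed, (bumpSeq n).hasCompactSupport_normed⟩

theorem eLpNorm_molli (n : ℕ) : eLpNorm (molli n) 1 = 1 := by
  rw [eLpNorm_one_eq_lintegral_enorm, molli]
  rw [← ofReal_integral_norm_eq_lintegral_enorm (bumpSeq n).integrable_normed]
  simp_rw [Real.norm_eq_abs, abs_of_nonneg ((bumpSeq n).nonneg_normed _)]
  simp [(bumpSeq n).integral_normed]

theorem mollify_molli_eq (n : ℕ) (f : Plane → ℝ) :
    mollify (molli n) f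
      = convolution ((bumpSeq n).normed volume) f (ContinuousLinearMap.lsmul ℝ ℝ) volume := by
  ext x
  rw [convolution_eq_swap, mollify_apply]
  simp [molli, mul_comm]

theorem eLpNorm_mollify_molli_le (n : ℕ) {f : Plane → ℝ} (hf : MemLp f 2) :
    eLpNorm (mollify (molli n) f) 2 ≤ eLpNorm f 2 := by
  simpa [eLpNorm_molli] using eLpNorm_mollify_le (isTest_molli n) hf

theorem tendsto_rOut_bumpSeq : Tendsto (fun n => (bumpSeq n).rOut) atTop (𝓝 0) :=
  tendsto_one_div_add_atTop_nhds_zero_nat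

theorem tendstoL2_mollify_of_isTest {f : Plane → ℝ} (hf : IsTest f) :
    TendstoL2 (fun n => mollify (molli n) f) f := by
  obtain ⟨B, hB⟩ := hf.2.exists_bound_of_continuous hf.1.continuous
  have hB0 : 0 ≤ B := (norm_nonneg _).trans (hB 0)
  obtain ⟨R, hR⟩ := hf.2.isCompact.isBounded.subset_closedBall (0 : Plane)
  have hz (x : Plane) (hx : R < ‖x‖) : f x = 0 := by
    by_contra h
    have := hR (subset_tsupport f h)
    simp at this
    linarith
  -- Radii at most `1` keep all supports in the ball of radius `R + 1`, where two values of `f`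
  -- differ by at most `2 * B`.
  refine .of_dominated (b := (Metric.closedBall (0 : Plane) (R + 1)).indicator fun _ => 2 * B)
    (fun n => memLp_mollify (isTest_molli n) hf.memLp) hf.memLp
    (memLp_indicator_const 2 Metric.isClosed_closedBall.measurableSet _
      (Or.inr measure_closedBall_lt_top.ne)) (fun n x => ?_) fun x => ?_
  · rw [mollify_molli_eq, ← Real.dist_eq]
    refine (bumpSeq n).dist_normed_convolution_le hf.1.continuous.aestronglyMeasurable ?_
    intro y hy
    by_cases hx : x ∈ Metric.closedBall (0 : Plane) (R + 1)
    · rw [indicator_of_mem hx, Real.dist_eq]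
      have h1 := hB x
      have h2 := hB y
      rw [Real.norm_eq_abs, abs_le] at *
      constructor <;> linarith
    · rw [indicator_of_notMem hx]
      have h1 : (bumpSeq n).rOut ≤ 1 := by
        change 1 / ((n : ℝ) + 1) ≤ 1
        rw [div_le_one (by positivity)]
        simp
      have hx' : R + 1 < ‖x‖ := by simpa using hx
      have hyx : ‖y - x‖ < 1 := by
        rw [← dist_eq_norm]; exact (Metric.mem_ball.1 hy).trans_le h1
      have hy' : R < ‖y‖ := by
        have := norm_sub_norm_le x y
        rw [norm_sub_rev] at this
        linarith
      rw [hz x (by linarith), hz y hy']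
      simp
  · simp_rw [mollify_molli_eq]
    exact ContDiffBump.convolution_tendsto_right_of_continuous tendsto_rOut_bumpSeq
      hf.1.continuous x

theorem mollify_sub {k f g : Plane → ℝ} (hk : IsTest k) (hf : MemLp f 2) (hg : MemLp g 2) :
    mollify k (f - g) = mollify k f - mollify k g := by
  ext x
  simp only [mollify_apply, Pi.sub_apply, sub_mul]
  exact integral_sub (hf.integrable_mul (hk.reflect x).memLp)
      (hg.integrable_mul (hk.reflect x).memLp)

/-- Young's inequality makes the mollifications contractions of $L^2$, so convergence extends from
the dense class of test functions by a three-epsilon argument. -/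
theorem tendstoL2_mollify {f : Plane → ℝ} (hf : MemLp f 2) :
    TendstoL2 (fun n => mollify (molli n) f) f := by
  refine ⟨fun n => memLp_mollify (isTest_molli n) hf, hf, ?_⟩
  rw [ENNReal.tendsto_atTop_zero]
  intro ε hε
  obtain ⟨δ, hδ, hδε⟩ : ∃ δ : ℝ, 0 < δ ∧ ENNReal.ofReal δ ≤ ε / 3 := by
    have h3 : ε / 3 ≠ 0 := by simpa using hε.ne'
    rcases eq_or_ne ε ⊤ with rfl | hε'
    · exact ⟨1, one_pos, by simp [ENNReal.top_div]⟩
    · have ht : ε / 3 ≠ ⊤ := ENNReal.div_ne_top hε' (by norm_num)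
      exact ⟨(ε / 3).toReal, ENNReal.toReal_pos h3 ht, by rw [ENNReal.ofReal_toReal ht]⟩
  obtain ⟨φ, hφc, hφs, hφ⟩ := hf.exist_eLpNorm_sub_le (by norm_num) (by norm_num) hδ
  have hφt : IsTest φ := ⟨hφs, hφc⟩
  obtain ⟨N, hN⟩ := ENNReal.tendsto_atTop_zero.1 (tendstoL2_mollify_of_isTest hφt).tendsto
    (ε / 3) (by simpa using hε.ne')
  refine ⟨N, fun n hn => ?_⟩
  have hfφ := hf.sub hφt.memLp
  have heq : mollify (molli n) f - f
      = mollify (molli n) (f - φ) + ((mollify (molli n) φ - φ) - (f - φ)) := by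
    rw [mollify_sub (isTest_molli n) hf hφt.memLp]; abel
  have hm := (memLp_mollify (isTest_molli n) hφt.memLp).sub hφt.memLp
  rw [heq]
  calc _ ≤ eLpNorm (mollify (molli n) (f - φ)) 2
        + (eLpNorm (mollify (molli n) φ - φ) 2 + eLpNorm (f - φ) 2) := by
        refine (eLpNorm_add_le (memLp_mollify (isTest_molli n) hfφ).1 (hm.sub hfφ).1
          (by norm_num)).trans ?_
        gcongr
        exact eLpNorm_sub_le hm.1 hfφ.1 (by norm_num)
    _ ≤ ε / 3 + (ε / 3 + ε / 3) := by
        gcongr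
        · exact (eLpNorm_mollify_molli_le n hfφ).trans (hφ.trans hδε)
        · exact hN n hn
        · exact hφ.trans hδε
    _ = ε := by rw [← add_assoc, ENNReal.add_thirds]

/-! ### Weak gradients and density of test functions. -/

/-- `g` is the weak gradient of the square integrable function `f`, and is square integrable. -/
structure HasWeakGrad (f : Plane → ℝ) (g : Fin 2 → Plane → ℝ) : Prop where
  memLp : MemLp f 2
  memLp_grad : ∀ i, MemLp (g i) 2
  integral_eq : ∀ φ, IsTest φ → ∀ i, ∫ x, f x * partialD i φ x = -∫ x, g i x * φ x

theorem H1.hasWeakGrad (p : H1) : HasWeakGrad p fun i x => p.1.snd x i :=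
  ⟨Lp.memLp _, memLp_coord _, p.2⟩

/-- The definition of the weak gradient, tested with the reflected kernel: the sign from the
reflection cancels the sign from integration by parts. -/
theorem HasWeakGrad.mollify_partialD {f : Plane → ℝ} {g : Fin 2 → Plane → ℝ}
    (h : HasWeakGrad f g) {k : Plane → ℝ} (hk : IsTest k) (i : Fin 2) :
    mollify (partialD i k) f = mollify k (g i) := by
  ext x
  have := h.integral_eq _ (hk.reflect x) i
  rw [partialD_reflect hk.differentiable] at this
  simp only [mul_neg, integral_neg, neg_inj] at this
  exact this

theorem HasWeakGrad.partialD_mollify {f : Plane → ℝ} {g : Fin 2 → Plane → ℝ}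
    (h : HasWeakGrad f g) {k : Plane → ℝ} (hk : IsTest k) (i : Fin 2) :
    partialD i (mollify k f) = mollify k (g i) := by
  rw [ZK.partialD_mollify hk (h.memLp.locallyIntegrable (by norm_num)), h.mollify_partialD hk]

theorem partialD_mul {f g : Plane → ℝ} (hf : Differentiable ℝ f) (hg : Differentiable ℝ g)
    (i : Fin 2) :
    partialD i (fun x => f x * g x) = fun x => f x * partialD i g x + partialD i f x * g x := by
  ext x
  simp only [partialD]
  rw [fderiv_fun_mul (hf x) (hg x)]
  simp [mul_comm]

theorem partialD_pow {f : Plane → ℝ} (hf : Differentiable ℝ f) (n : ℕ) (i : Fin 2) :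
    partialD i (fun x => f x ^ n) = fun x => n * f x ^ (n - 1) * partialD i f x := by
  ext x
  simp only [partialD]
  rw [fderiv_fun_pow _ (hf x)]
  simp

/-- Test functions are dense in `H¹`. -/
theorem HasWeakGrad.exists_isTest_tendsto {f : Plane → ℝ} {g : Fin 2 → Plane → ℝ}
    (h : HasWeakGrad f g) : ∃ φ : ℕ → Plane → ℝ, (∀ n, IsTest (φ n)) ∧ TendstoL2 φ f ∧
      ∀ i, TendstoL2 (fun n => partialD i (φ n)) (g i) := by
  -- Mollify, then cut off with $\chi(x/(n+1))$, whose gradient is $O(1/(n+1))$ uniformly.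
  let χ : ContDiffBump (0 : Plane) := ⟨1, 2, one_pos, one_lt_two⟩
  have hχ : IsTest χ := ⟨χ.contDiff, χ.hasCompactSupport⟩
  let r : ℕ → ℝ := fun n => 1 / ((n : ℝ) + 1)
  have hr (n : ℕ) : 0 < r n := by positivity
  have hrt : Tendsto r atTop (𝓝 0) := tendsto_one_div_add_atTop_nhds_zero_nat
  let c : ℕ → Plane → ℝ := fun n x => χ (r n • x)
  have hc (n : ℕ) : IsTest (c n) := by
    refine ⟨hχ.1.comp (contDiff_const_smul (r n)), ?_⟩
    exact hχ.2.comp_homeomorph (Homeomorph.smulOfNeZero (r n) (hr n).ne')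
  have hdc (n : ℕ) (i : Fin 2) : partialD i (c n) = fun x => r n * partialD i χ (r n • x) := by
    ext x
    have h1 : HasFDerivAt (c n) ((fderiv ℝ χ (r n • x)).comp
        (r n • ContinuousLinearMap.id ℝ Plane)) x :=
      (hχ.differentiable (r n • x)).hasFDerivAt.comp x ((hasFDerivAt_id x).const_smul (r n))
    simp [partialD, h1.fderiv]
  have hct (x : Plane) : Tendsto (fun n => c n x) atTop (𝓝 1) := by
    have h1 : Tendsto (fun n => r n • x) atTop (𝓝 0) := by simpa using hrt.smul_const x
    have h2 := (hχ.1.continuous.tendsto 0).comp h1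
    rwa [χ.one_of_mem_closedBall (Metric.mem_closedBall_self χ.rIn_pos.le)] at h2
  have hc1 (n : ℕ) (x : Plane) : |c n x| ≤ 1 := by
    rw [abs_of_nonneg χ.nonneg]; exact χ.le_one
  have hT {q : Plane → ℝ} (hq : MemLp q 2) :
      TendstoL2 (fun n x => mollify (molli n) q x * c n x) q := by
    have := (tendstoL2_mollify hq).mul_seq (c := c) (d := fun _ => 1) (C := 1)
      (fun n => (hc n).1.continuous.aestronglyMeasurable) aestronglyMeasurable_const hc1
      (by simp) hct
    simpa using this
  have hm (n : ℕ) : ContDiff ℝ ∞ (mollify (molli n) f) :=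
    contDiff_mollify (isTest_molli n) (h.memLp.locallyIntegrable (by norm_num))
  refine ⟨fun n x => mollify (molli n) f x * c n x,
    fun n => ⟨(hm n).mul (hc n).1, (hc n).2.mul_left⟩, hT h.memLp, fun i => ?_⟩
  obtain ⟨B, hB⟩ := (hχ.isTest_partialD i).2.exists_bound_of_continuous
      (hχ.isTest_partialD i).1.continuous
  have hr1 (n : ℕ) : r n ≤ 1 := by
    change 1 / ((n : ℝ) + 1) ≤ 1
    rw [div_le_one (by positivity)]
    simp
  have hB0 : 0 ≤ B := (norm_nonneg _).trans (hB 0)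
  -- The part of the gradient falling on the cutoff disappears in the limit; its limit is written as
  -- a product with `0` to fit `TendstoL2.mul_seq`.
  have h2 : TendstoL2 (fun n x => mollify (molli n) f x * partialD i (c n) x)
      (fun x => f x * 0) := by
    refine (tendstoL2_mollify h.memLp).mul_seq (d := fun _ => 0) (C := B)
      (fun n => ((hc n).isTest_partialD i).1.continuous.aestronglyMeasurable)
          aestronglyMeasurable_const
      (fun n x => ?_) (by simpa) fun x => ?_
    · rw [hdc, abs_mul, abs_of_pos (hr n)]
      calc r n * |partialD i χ (r n • x)| ≤ 1 * B := by
            gcongr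
            · exact hr1 n
            · exact hB _
        _ = B := one_mul B
    · have h0 : Tendsto (fun n => r n * B) atTop (𝓝 0) := by simpa using hrt.mul_const B
      refine squeeze_zero_norm (fun n => ?_) h0
      rw [hdc, norm_mul, Real.norm_of_nonneg (hr n).le]
      gcongr
      exact hB _
  have h3 := h2.add (hT (h.memLp_grad i))
  convert h3 using 2 with n x
  · rw [partialD_mul ((hm n).differentiable (by simp)) (hc n).differentiable,
      h.partialD_mollify (isTest_molli n)]
  · simp

theorem integrable_mul_of_memLp {f g : Plane → ℝ} (hf : MemLp f 2) (hg : MemLp g 2) :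
    Integrable fun x => f x * g x := hf.integrable_mul hg

theorem IsTest.integrable {φ : Plane → ℝ} (h : IsTest φ) : Integrable φ :=
  h.1.continuous.integrable_of_hasCompactSupport h.2

theorem IsTest.continuous {φ : Plane → ℝ} (h : IsTest φ) : Continuous φ := h.1.continuous

theorem IsTest.hasWeakGrad {f : Plane → ℝ} (hf : IsTest f) :
    HasWeakGrad f fun i => partialD i f := by
  refine ⟨hf.memLp, hf.memLp_partialD, fun φ hφ i => ?_⟩
  rw [eq_neg_iff_add_eq_zero, ← integral_add (hf.mul (hφ.isTest_partialD i)).integrable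
    ((hf.isTest_partialD i).mul hφ).integrable]
  refine integral_lineDeriv_eq_zero (v := EuclideanSpace.single i 1) (hf.mul hφ).integrable
    ((hf.mul (hφ.isTest_partialD i)).integrable.add ((hf.isTest_partialD i).mul hφ).integrable)
        fun x => ?_
  have := hasLineDerivAt_partialD (hf.mul hφ).differentiable i x
  rwa [partialD_mul hf.differentiable hφ.differentiable] at this

theorem HasWeakGrad.add {f f' : Plane → ℝ} {g g' : Fin 2 → Plane → ℝ} (h : HasWeakGrad f g)
    (h' : HasWeakGrad f' g') :
    HasWeakGrad (fun x => f x + f' x) (fun i x => g i x + g' i x) := by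
  refine ⟨h.memLp.add h'.memLp, fun i => (h.memLp_grad i).add (h'.memLp_grad i), fun φ hφ i => ?_⟩
  simp_rw [add_mul]
  rw [integral_add (integrable_mul_of_memLp h.memLp (hφ.memLp_partialD i))
    (integrable_mul_of_memLp h'.memLp (hφ.memLp_partialD i)),
    integral_add (integrable_mul_of_memLp (h.memLp_grad i) hφ.memLp)
    (integrable_mul_of_memLp (h'.memLp_grad i) hφ.memLp), h.integral_eq φ hφ, h'.integral_eq φ hφ]
  ring

theorem HasWeakGrad.neg {f : Plane → ℝ} {g : Fin 2 → Plane → ℝ} (h : HasWeakGrad f g) :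
    HasWeakGrad (fun x => -f x) (fun i x => -g i x) := by
  refine ⟨h.memLp.neg, fun i => (h.memLp_grad i).neg, fun φ hφ i => ?_⟩
  simp_rw [neg_mul, integral_neg, h.integral_eq φ hφ]

theorem HasWeakGrad.sub {f f' : Plane → ℝ} {g g' : Fin 2 → Plane → ℝ} (h : HasWeakGrad f g)
    (h' : HasWeakGrad f' g') :
    HasWeakGrad (fun x => f x - f' x) (fun i x => g i x - g' i x) := by
  simpa only [sub_eq_add_neg] using h.add h'.neg

theorem HasWeakGrad.congr {f f' : Plane → ℝ} {g : Fin 2 → Plane → ℝ} (h : HasWeakGrad f g)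
    (hf : f =ᵐ[volume] f') : HasWeakGrad f' g := by
  refine ⟨(memLp_congr_ae hf).1 h.memLp, h.memLp_grad, fun φ hφ i => ?_⟩
  rw [← h.integral_eq φ hφ i]
  refine integral_congr_ae ?_
  filter_upwards [hf] with x hx
  rw [hx]

theorem memLp_translate {f : Plane → ℝ} (hf : MemLp f 2) (y : Plane) :
    MemLp (fun x => f (x + y)) 2 :=
  hf.comp_measurePreserving (measurePreserving_add_right volume y)

theorem HasWeakGrad.translate {f : Plane → ℝ} {g : Fin 2 → Plane → ℝ} (h : HasWeakGrad f g)
    (y : Plane) : HasWeakGrad (fun x => f (x + y)) (fun i x => g i (x + y)) := by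
  refine ⟨memLp_translate h.memLp y, fun i => memLp_translate (h.memLp_grad i) y, fun φ hφ i => ?_⟩
  have h1 := h.integral_eq _ (hφ.translate (-y)) i
  rw [partialD_comp_add, ← integral_add_right_eq_self _ y,
    ← integral_add_right_eq_self (fun x => g i x * _) y] at h1
  simpa using h1

/-! ### Sobolev and Gagliardo-Nirenberg inequalities. -/

/-- The squared `H¹` norm of a function `f` with gradient `g`. -/
noncomputable def energy (f : Plane → ℝ) (g : Fin 2 → Plane → ℝ) : ℝ :=
  ∫ x, f x ^ 2 + ∑ i, g i x ^ 2

theorem HasWeakGrad.integrable_energy {f : Plane → ℝ} {g : Fin 2 → Plane → ℝ}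
    (h : HasWeakGrad f g) : Integrable fun x => f x ^ 2 + ∑ i, g i x ^ 2 :=
  h.memLp.integrable_sq.add (integrable_finsetSum _ fun i _ => (h.memLp_grad i).integrable_sq)

theorem energy_nonneg (f : Plane → ℝ) (g : Fin 2 → Plane → ℝ) : 0 ≤ energy f g :=
  integral_nonneg fun _ => by positivity

theorem HasWeakGrad.integral_sq_le_energy {f : Plane → ℝ} {g : Fin 2 → Plane → ℝ}
    (h : HasWeakGrad f g) : ∫ x, f x ^ 2 ≤ energy f g := by
  refine integral_mono h.memLp.integrable_sq h.integrable_energy fun x => ?_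
  have : 0 ≤ ∑ i, g i x ^ 2 := by positivity
  simpa using this

theorem HasWeakGrad.integral_grad_sq_le_energy {f : Plane → ℝ} {g : Fin 2 → Plane → ℝ}
    (h : HasWeakGrad f g) : ∫ x, (g 0 x ^ 2 + g 1 x ^ 2) ≤ energy f g := by
  refine integral_mono ((h.memLp_grad 0).integrable_sq.add (h.memLp_grad 1).integrable_sq)
    h.integrable_energy fun x => ?_
  simp [Fin.sum_univ_two, sq_nonneg]

theorem integral_mul_sq_le {a b : Plane → ℝ} (ha : MemLp a 2) (hb : MemLp b 2) :
    (∫ x, a x * b x) ^ 2 ≤ (∫ x, a x ^ 2) * ∫ x, b x ^ 2 := by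
  have key {a b : Plane → ℝ} (ha : MemLp a 2) (hb : MemLp b 2) :
      ∫ x, a x * b x = inner ℝ (hb.toLp b) (ha.toLp a) := by
    rw [L2.inner_def]
    refine integral_congr_ae ?_
    filter_upwards [ha.coeFn_toLp, hb.coeFn_toLp] with x h1 h2
    simp [h1, h2]
  simp_rw [sq, key ha hb, key ha ha, key hb hb]
  rw [mul_comm (inner ℝ (ha.toLp a) (ha.toLp a))]
  exact (real_inner_mul_inner_self_le _ _)

/-- The Gagliardo-Nirenberg-Sobolev inequality on the plane. -/
theorem exists_sobolev : ∃ C : ℝ, 0 < C ∧ ∀ F : Plane → ℝ, ContDiff ℝ 1 F → HasCompactSupport F →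
    ∫ x, F x ^ 2 ≤ C * (∫ x, (|partialD 0 F x| + |partialD 1 F x|)) ^ 2 := by
  let C := lintegralPowLePowLIntegralFDerivConst (volume : Measure Plane) 2
  -- The added `1` only makes the constant strictly positive.
  refine ⟨C + 1, by positivity, fun F hF hc => ?_⟩
  -- The Sobolev exponent is the conjugate of the dimension, which is `2` in the plane.
  have h2 : Real.HolderConjugate (Module.finrank ℝ Plane) 2 := by
    rw [finrank_euclideanSpace_fin]
    exact_mod_cast Real.HolderConjugate.two_two
  have h := lintegral_pow_le_pow_lintegral_fderiv (μ := volume) hF hc h2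
  have hcont (i : Fin 2) : Continuous (partialD i F) :=
    (hF.continuous_fderiv one_ne_zero).clm_apply continuous_const
  have hint (i : Fin 2) : Integrable (partialD i F) :=
    (hcont i).integrable_of_hasCompactSupport (hc.fderiv_apply (𝕜 := ℝ) _)
  have hb (x : Plane) : ‖fderiv ℝ F x‖ ≤ |partialD 0 F x| + |partialD 1 F x| := by
    refine ContinuousLinearMap.opNorm_le_bound _ (by positivity) fun v => ?_
    have hv : v = ∑ i, v i • EuclideanSpace.single i (1 : ℝ) := by
      ext j
      fin_cases j <;> simp [Fin.sum_univ_two]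
    have hvi (i : Fin 2) : |v i| ≤ ‖v‖ := PiLp.norm_apply_le v i
    conv_lhs => rw [hv]
    rw [map_sum, Fin.sum_univ_two, map_smul, map_smul]
    refine (norm_add_le _ _).trans ?_
    rw [norm_smul, norm_smul, add_mul, mul_comm ‖v 0‖, mul_comm ‖v 1‖]
    exact add_le_add (mul_le_mul_of_nonneg_left (hvi 0) (abs_nonneg _))
      (mul_le_mul_of_nonneg_left (hvi 1) (abs_nonneg _))
  set J := ∫ x, (|partialD 0 F x| + |partialD 1 F x|) with hJ
  have hJ0 : 0 ≤ J := integral_nonneg fun x => by positivity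
  have hJl : ∫⁻ x, ‖fderiv ℝ F x‖ₑ ≤ ENNReal.ofReal J := by
    have hi : Integrable fun x => |partialD 0 F x| + |partialD 1 F x| :=
      (hint 0).abs.add (hint 1).abs
    rw [hJ, ofReal_integral_eq_lintegral_ofReal hi (Eventually.of_forall fun x => by
      dsimp; positivity)]
    refine lintegral_mono fun x => ?_
    rw [← ofReal_norm]
    exact ENNReal.ofReal_le_ofReal (hb x)
  have hFl : ENNReal.ofReal (∫ x, F x ^ 2) = ∫⁻ x, ‖F x‖ₑ ^ (2 : ℝ) := by
    rw [ofReal_integral_eq_lintegral_ofReal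
      (hF.continuous.memLp_of_hasCompactSupport hc).integrable_sq
      (Eventually.of_forall fun x => sq_nonneg _)]
    refine lintegral_congr fun x => ?_
    rw [← sq_abs, ENNReal.ofReal_pow (abs_nonneg _), ← Real.enorm_eq_ofReal_abs]
    simp
  have hfin : ENNReal.ofReal (∫ x, F x ^ 2) ≤ ENNReal.ofReal (C * J ^ 2) := by
    rw [hFl, ENNReal.ofReal_mul (p := (C : ℝ)) C.2, ENNReal.ofReal_pow hJ0]
    refine h.trans ?_
    rw [ENNReal.ofReal_coe_nnreal]
    simp only [ENNReal.rpow_ofNat]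
    gcongr
  have := (ENNReal.ofReal_le_ofReal_iff (by positivity)).1 hfin
  nlinarith [sq_nonneg J]

/-- The induction step for the embedding into $L^{2n}$. The $L^1$ Sobolev inequality is applied to
$\varphi^{n+2}$, with gradient $(n+2)\varphi^{n+1}\nabla\varphi$, and Cauchy-Schwarz separates
$\varphi^{n+1}$ from $\nabla\varphi$. -/
theorem IsTest.integral_pow_le {C : ℝ} (hC : 0 < C)
    (hS : ∀ F : Plane → ℝ, ContDiff ℝ 1 F → HasCompactSupport F →
      ∫ x, F x ^ 2 ≤ C * (∫ x, (|partialD 0 F x| + |partialD 1 F x|)) ^ 2)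
    {φ : Plane → ℝ} (hφ : IsTest φ) (n : ℕ) :
    ∫ x, φ x ^ (2 * (n + 2)) ≤ 2 * C * (n + 2) ^ 2 * (∫ x, φ x ^ (2 * (n + 1)))
      * energy φ fun i => partialD i φ := by
  have hF := hφ.pow (n := n + 2) (by simp)
  have h1 := hS _ (hF.1.of_le (by simp)) hF.2
  have hd (i : Fin 2) : partialD i (fun x => φ x ^ (n + 2))
      = fun x => (n + 2) * φ x ^ (n + 1) * partialD i φ x := by
    rw [partialD_pow hφ.differentiable]; simp
  have hp := hφ.pow (n := n + 1) (by simp)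
  have hD : MemLp (fun x => |partialD 0 φ x| + |partialD 1 φ x|) 2 :=
    (hφ.memLp_partialD 0).abs.add (hφ.memLp_partialD 1).abs
  have h2 : ∫ x, (|partialD 0 (fun x => φ x ^ (n + 2)) x| + |partialD 1 (fun x => φ x ^ (n + 2)) x|)
      = (n + 2) * ∫ x, |φ x ^ (n + 1)| * (|partialD 0 φ x| + |partialD 1 φ x|) := by
    rw [← integral_const_mul]
    refine integral_congr_ae (Eventually.of_forall fun x => ?_)
    simp only [hd, abs_mul]
    rw [abs_of_nonneg (by positivity : (0 : ℝ) ≤ n + 2)]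
    ring
  have h3 := integral_mul_sq_le hp.memLp.abs hD
  have h4 : ∫ x, (|partialD 0 φ x| + |partialD 1 φ x|) ^ 2 ≤ 2 * energy φ
      fun i => partialD i φ := by
    calc _ ≤ ∫ x, 2 * (partialD 0 φ x ^ 2 + partialD 1 φ x ^ 2) := by
          refine integral_mono hD.integrable_sq
            (((hφ.memLp_partialD 0).integrable_sq.add
              (hφ.memLp_partialD 1).integrable_sq).const_mul 2) fun x => ?_
          dsimp only
          rw [← sq_abs (partialD 0 φ x), ← sq_abs (partialD 1 φ x)]
          nlinarith [sq_nonneg (|partialD 0 φ x| - |partialD 1 φ x|)]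
      _ ≤ _ := by
        rw [integral_const_mul]
        gcongr
        exact hφ.hasWeakGrad.integral_grad_sq_le_energy
  have h5 : ∫ x, |φ x ^ (n + 1)| ^ 2 = ∫ x, φ x ^ (2 * (n + 1)) := by
    simp_rw [sq_abs, ← pow_mul, mul_comm 2]
  have h6 : 0 ≤ ∫ x, φ x ^ (2 * (n + 1)) := integral_nonneg fun x => by
    simp only [pow_mul]; positivity
  rw [h2, mul_pow] at h1
  simp only [Pi.abs_apply] at h3
  rw [h5] at h3
  calc ∫ x, φ x ^ (2 * (n + 2)) = ∫ x, (φ x ^ (n + 2)) ^ 2 := by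
        simp_rw [← pow_mul, mul_comm 2]
    _ ≤ _ := h1
    _ ≤ C * ((n + 2) ^ 2 * ((∫ x, φ x ^ (2 * (n + 1))) *
        (2 * energy φ fun i => partialD i φ))) := by
        gcongr
        exact h3.trans (by gcongr)
    _ = _ := by ring

theorem TendstoL2.of_integral_sq {F : ℕ → Plane → ℝ} {f : Plane → ℝ} (hF : ∀ n, MemLp (F n) 2)
    (hf : MemLp f 2) (h : Tendsto (fun n => ∫ x, (F n x - f x) ^ 2) atTop (𝓝 0)) :
    TendstoL2 F f := by
  refine .of_sq hF hf ?_
  have := ENNReal.tendsto_ofReal h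
  rw [ENNReal.ofReal_zero] at this
  refine this.congr fun n => ?_
  have hi : Integrable fun x => (F n x - f x) ^ 2 := ((hF n).sub hf).integrable_sq
  rw [ofReal_integral_eq_lintegral_ofReal hi (Eventually.of_forall fun x => sq_nonneg _)]
  refine lintegral_congr fun x => ?_
  rw [← sq_abs, ENNReal.ofReal_pow (abs_nonneg _), ← Real.enorm_eq_ofReal_abs]

theorem TendstoL2.neg {F : ℕ → Plane → ℝ} {f : Plane → ℝ} (hF : TendstoL2 F f) :
    TendstoL2 (fun n x => -F n x) (fun x => -f x) := by
  have := hF.mul_bdd (p := fun _ => -1) (C := 1) aestronglyMeasurable_const (by simp)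
  simpa using this

theorem tendsto_energy {F : ℕ → Plane → ℝ} {f : Plane → ℝ} {G : ℕ → Fin 2 → Plane → ℝ}
    {g : Fin 2 → Plane → ℝ} (hF : TendstoL2 F f) (hG : ∀ i, TendstoL2 (fun n => G n i) (g i)) :
    Tendsto (fun n => energy (F n) (G n)) atTop (𝓝 (energy f g)) := by
  have h {a : Plane → ℝ} {b : Fin 2 → Plane → ℝ} (ha : MemLp a 2) (hb : ∀ i, MemLp (b i) 2) :
      energy a b = (∫ x, a x * a x) + ∑ i, ∫ x, b i x * b i x := by
    simp_rw [energy, sq]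
    rw [integral_add (integrable_mul_of_memLp ha ha)
      (integrable_finsetSum _ fun i _ => integrable_mul_of_memLp (hb i) (hb i)),
      integral_finsetSum]
    exact fun i _ => integrable_mul_of_memLp (hb i) (hb i)
  rw [h hF.memLp_lim fun i => (hG i).memLp_lim]
  simp_rw [h (hF.memLp _) fun i => (hG i).memLp _]
  exact (hF.integral_mul hF).add (tendsto_finsetSum _ fun i _ => (hG i).integral_mul (hG i))

/-- If the integrals of nonnegative continuous functions of approximations converge, the limit
function is integrable, with at most that integral. -/
theorem TendstoL2.integrable_and_integral_le {F : ℕ → Plane → ℝ} {f : Plane → ℝ}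
    (hF : TendstoL2 F f) {H : Plane → ℝ → ℝ} (hH : ∀ x, Continuous (H x))
    (hH0 : ∀ x y, 0 ≤ H x y) (hint : ∀ n, Integrable fun x => H x (F n x))
    (hm : AEStronglyMeasurable fun x => H x (f x)) {a : ℕ → ℝ} {b : ℝ}
    (ha : Tendsto a atTop (𝓝 b)) (hle : ∀ n, ∫ x, H x (F n x) ≤ a n) :
    Integrable (fun x => H x (f x)) ∧ ∫ x, H x (f x) ≤ b := by
  -- Fatou's lemma along a subsequence converging almost everywhere; only the bounds `a n` have to
  -- converge.
  obtain ⟨s, hs, hae⟩ := hF.exists_subseq_ae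
  have h1 : ∫⁻ x, ENNReal.ofReal (H x (f x)) ≤ ENNReal.ofReal b := by
    calc ∫⁻ x, ENNReal.ofReal (H x (f x))
        = ∫⁻ x, liminf (fun n => ENNReal.ofReal (H x (F (s n) x))) atTop := by
          refine lintegral_congr_ae ?_
          filter_upwards [hae] with x hx
          exact (ENNReal.tendsto_ofReal (((hH x).tendsto _).comp hx)).liminf_eq.symm
      _ ≤ liminf (fun n => ∫⁻ x, ENNReal.ofReal (H x (F (s n) x))) atTop :=
        lintegral_liminf_le' fun n => (hint (s n)).1.aemeasurable.ennreal_ofReal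
      _ ≤ liminf (fun n => ENNReal.ofReal (a (s n))) atTop := by
        refine liminf_le_liminf (Eventually.of_forall fun n => ?_)
        rw [← ofReal_integral_eq_lintegral_ofReal (hint _) (Eventually.of_forall fun x => hH0 _ _)]
        exact ENNReal.ofReal_le_ofReal (hle _)
      _ = ENNReal.ofReal b :=
        (ENNReal.tendsto_ofReal (ha.comp hs.tendsto_atTop)).liminf_eq
  have hb : 0 ≤ b := ge_of_tendsto' ha fun n => (integral_nonneg fun x => hH0 _ _).trans (hle n)
  refine ⟨⟨hm, ?_⟩, ?_⟩
  · rw [hasFiniteIntegral_iff_ofReal (Eventually.of_forall fun x => hH0 _ _)]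
    exact h1.trans_lt ENNReal.ofReal_lt_top
  · rw [integral_eq_lintegral_of_nonneg_ae (Eventually.of_forall fun x => hH0 _ _) hm]
    exact ENNReal.toReal_le_of_le_ofReal hb h1

/-- The embedding of `H¹(ℝ²)` into `L^{2n}`. -/
theorem exists_integral_pow_le (n : ℕ) : ∃ K : ℝ, 0 < K ∧ ∀ (f : Plane → ℝ)
    (g : Fin 2 → Plane → ℝ), HasWeakGrad f g → Integrable (fun x => f x ^ (2 * (n + 1))) ∧
      ∫ x, f x ^ (2 * (n + 1)) ≤ K * energy f g ^ (n + 1) := by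
  obtain ⟨C, hC, hS⟩ := exists_sobolev
  have htest : ∃ K : ℝ, 0 < K ∧ ∀ φ : Plane → ℝ, IsTest φ →
      ∫ x, φ x ^ (2 * (n + 1)) ≤ K * (energy φ fun i => partialD i φ) ^ (n + 1) := by
    induction n with
    | zero =>
      refine ⟨1, one_pos, fun φ hφ => ?_⟩
      simpa using hφ.hasWeakGrad.integral_sq_le_energy
    | succ n ih =>
      obtain ⟨K, hK, ih⟩ := ih
      refine ⟨2 * C * (n + 2) ^ 2 * K, by positivity, fun φ hφ => ?_⟩
      have hE := energy_nonneg φ fun i => partialD i φ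
      calc _ ≤ _ := hφ.integral_pow_le hC hS n
        _ ≤ 2 * C * (n + 2) ^ 2 * (K * (energy φ fun i => partialD i φ) ^ (n + 1))
            * energy φ fun i => partialD i φ := by gcongr; exact ih φ hφ
        _ = _ := by ring
  obtain ⟨K, hK, htest⟩ := htest
  refine ⟨K, hK, fun f g h => ?_⟩
  obtain ⟨φ, hφ, hφf, hφg⟩ := h.exists_isTest_tendsto
  refine hφf.integrable_and_integral_le (H := fun _ y => y ^ (2 * (n + 1)))
    (fun _ => by fun_prop) (fun _ y => by rw [pow_mul]; positivity)
    (fun m => ((hφ m).pow (by simp)).integrable) (h.memLp.1.pow _)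
    (((tendsto_energy hφf hφg).pow (n + 1)).const_mul K) fun m => htest _ (hφ m)

theorem HasWeakGrad.memLp_pow {f : Plane → ℝ} {g : Fin 2 → Plane → ℝ} (h : HasWeakGrad f g)
    (n : ℕ) : MemLp (fun x => f x ^ (n + 1)) 2 := by
  obtain ⟨K, -, hK⟩ := exists_integral_pow_le n
  refine (memLp_two_iff_integrable_sq (h.memLp.1.pow _)).2 ?_
  refine (hK f g h).1.congr (Eventually.of_forall fun x => ?_)
  simp only [Pi.pow_apply]
  ring

/-- The weighted Gagliardo-Nirenberg inequality. -/
theorem exists_weighted_gagliardoNirenberg : ∃ K : ℝ, 0 < K ∧ ∀ (f : Plane → ℝ)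
    (g : Fin 2 → Plane → ℝ) (w : Plane → ℝ) (W : ℝ), HasWeakGrad f g → ContDiff ℝ 1 w →
      (∀ i x, |partialD i w x| ≤ |w x|) → (∀ x, |w x| ≤ W) →
      ∫ x, f x ^ 4 * w x ^ 2
        ≤ K * (∫ x, f x ^ 2) * ∫ x, (f x ^ 2 + ∑ i, g i x ^ 2) * w x ^ 2 := by
  obtain ⟨C, hC, hS⟩ := exists_sobolev
  refine ⟨C * 12, by positivity, fun f g w W h hw hw1 hW => ?_⟩
  have hwW (x : Plane) : |w x ^ 2| ≤ W ^ 2 := by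
    rw [abs_pow]; exact pow_le_pow_left₀ (abs_nonneg _) (hW x) 2
  have hwc : Continuous w := hw.continuous
  have hw2 : AEStronglyMeasurable (fun x => w x ^ 2) (volume : Measure Plane) :=
    (hwc.pow 2).aestronglyMeasurable
  have hexp {a : Plane → ℝ} {b : Fin 2 → Plane → ℝ} (ha : MemLp a 2) (hb : ∀ i, MemLp (b i) 2) :
      ∫ x, (a x ^ 2 + ∑ i, b i x ^ 2) * w x ^ 2
        = (∫ x, a x * a x * w x ^ 2) + ∑ i, ∫ x, b i x * b i x * w x ^ 2 := by
    have hi {c : Plane → ℝ} (hc : MemLp c 2) : Integrable fun x => c x * c x * w x ^ 2 := by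
      simp_rw [mul_assoc]
      exact hc.integrable_mul (memLp_mul_bdd hc hw2 hwW)
    rw [← integral_finsetSum _ fun i _ => hi (hb i), ← integral_add (hi ha)
      (integrable_finsetSum _ fun i _ => hi (hb i))]
    simp_rw [← Finset.sum_mul, ← add_mul, sq]
  have htest (φ : Plane → ℝ) (hφ : IsTest φ) : ∫ x, φ x ^ 4 * w x ^ 2
      ≤ C * 12 * (∫ x, φ x * φ x)
        * ((∫ x, φ x * φ x * w x ^ 2) + ∑ i, ∫ x, partialD i φ x * partialD i φ x * w x ^ 2) := by
    -- Sobolev for $\varphi^2w$. As $|\partial_iw|\le|w|$, its gradient is at most $|\varphi|$ times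
    -- a quantity linear in $(\varphi,\nabla\varphi)$ times $|w|$, so Cauchy-Schwarz leaves one
    -- unweighted factor $\int\varphi^2$.
    have h1 := hS (fun x => φ x ^ 2 * w x) (((hφ.1.of_le (by simp)).pow 2).mul hw)
      ((hφ.pow two_ne_zero).2.mul_right)
    have hd (i : Fin 2) (x : Plane) : |partialD i (fun x => φ x ^ 2 * w x) x|
        ≤ |φ x| * ((2 * |partialD i φ x| + |φ x|) * |w x|) := by
      rw [partialD_mul (hφ.pow two_ne_zero).differentiable (hw.differentiable one_ne_zero),
        partialD_pow hφ.differentiable]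
      have := hw1 i x
      calc _ ≤ |φ x ^ 2 * partialD i w x| + |(2 : ℕ) * φ x ^ (2 - 1) * partialD i φ x * w x| :=
            abs_add_le _ _
        _ = |φ x| ^ 2 * |partialD i w x| + 2 * |φ x| * |partialD i φ x| * |w x| := by
            simp [abs_mul]
        _ ≤ |φ x| ^ 2 * |w x| + 2 * |φ x| * |partialD i φ x| * |w x| := by gcongr
        _ = _ := by ring
    have hB : MemLp (fun x => (2 * |partialD 0 φ x| + 2 * |partialD 1 φ x| + 2 * |φ x|) * |w x|)
        2 :=
      memLp_mul_bdd ((((hφ.memLp_partialD 0).abs.const_mul 2).add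
        ((hφ.memLp_partialD 1).abs.const_mul 2)).add (hφ.memLp.abs.const_mul 2))
        hwc.abs.aestronglyMeasurable (fun x => by simpa using hW x)
    have h2 : ∫ x, (|partialD 0 (fun x => φ x ^ 2 * w x) x|
        + |partialD 1 (fun x => φ x ^ 2 * w x) x|)
        ≤ ∫ x, |φ x| * ((2 * |partialD 0 φ x| + 2 * |partialD 1 φ x| + 2 * |φ x|) * |w x|) := by
      refine integral_mono_of_nonneg (Eventually.of_forall fun x => by dsimp; positivity)
        (hφ.memLp.abs.integrable_mul hB) (Eventually.of_forall fun x => ?_)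
      refine (add_le_add (hd 0 x) (hd 1 x)).trans_eq ?_
      ring
    have h3 := integral_mul_sq_le hφ.memLp.abs hB
    simp only [Pi.abs_apply] at h3
    -- The constant is that of $(2a+2b+2c)^2\le12(a^2+b^2+c^2)$.
    have h4 : ∫ x, ((2 * |partialD 0 φ x| + 2 * |partialD 1 φ x| + 2 * |φ x|) * |w x|) ^ 2
        ≤ 12 * ∫ x, (φ x ^ 2 + ∑ i, partialD i φ x ^ 2) * w x ^ 2 := by
      rw [← integral_const_mul]
      refine integral_mono_of_nonneg (Eventually.of_forall fun x => sq_nonneg _) ?_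
        (Eventually.of_forall fun x => ?_)
      · exact ((hφ.hasWeakGrad.integrable_energy).mul_bdd hw2
          (Eventually.of_forall hwW)).const_mul 12
      · dsimp only
        rw [mul_pow, sq_abs, ← mul_assoc, Fin.sum_univ_two]
        refine mul_le_mul_of_nonneg_right ?_ (sq_nonneg _)
        rw [← sq_abs (partialD 0 φ x), ← sq_abs (partialD 1 φ x), ← sq_abs (φ x)]
        nlinarith [sq_nonneg (|partialD 0 φ x| - |partialD 1 φ x|),
          sq_nonneg (|partialD 0 φ x| - |φ x|), sq_nonneg (|partialD 1 φ x| - |φ x|)]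
    rw [← hexp hφ.memLp hφ.memLp_partialD]
    simp only [sq_abs] at h3
    simp_rw [← sq (φ _)]
    have h0 : 0 ≤ ∫ x, φ x ^ 2 := integral_nonneg fun x => sq_nonneg _
    have h0' : 0 ≤ ∫ x, (|partialD 0 (fun x => φ x ^ 2 * w x) x|
        + |partialD 1 (fun x => φ x ^ 2 * w x) x|) := integral_nonneg fun x => by positivity
    calc ∫ x, φ x ^ 4 * w x ^ 2 = ∫ x, (φ x ^ 2 * w x) ^ 2 := by
          congr 1; ext x; ring
      _ ≤ _ := h1
      _ ≤ C * (∫ x, |φ x| * ((2 * |partialD 0 φ x| + 2 * |partialD 1 φ x| + 2 * |φ x|) * |w x|)) ^ 2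
          := by gcongr
      _ ≤ C * ((∫ x, φ x ^ 2) * (12 * ∫ x, (φ x ^ 2 + ∑ i, partialD i φ x ^ 2) * w x ^ 2)) := by
          gcongr
          exact h3.trans (by gcongr)
      _ = _ := by ring
  obtain ⟨φ, hφ, hφf, hφg⟩ := h.exists_isTest_tendsto
  rw [hexp h.memLp h.memLp_grad]
  simp_rw [sq (f _)]
  refine (hφf.integrable_and_integral_le (H := fun x y => y ^ 4 * w x ^ 2)
    (fun _ => by fun_prop) (fun _ y => by positivity)
    (fun m => ((hφ m).pow four_ne_zero).integrable.mul_bdd hw2 (Eventually.of_forall hwW))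
    ((h.memLp.1.pow 4).mul hw2) ?_ fun m => htest _ (hφ m)).2
  exact ((hφf.integral_mul hφf).const_mul _).mul ((hφf.integral_mul_mul hφf hw2 hwW).add
    (tendsto_finsetSum _ fun i _ => (hφg i).integral_mul_mul (hφg i) hw2 hwW))

theorem TendstoL2.sub {F G : ℕ → Plane → ℝ} {f g : Plane → ℝ} (hF : TendstoL2 F f)
    (hG : TendstoL2 G g) : TendstoL2 (fun n x => F n x - G n x) (fun x => f x - g x) := by
  simpa only [sub_eq_add_neg] using hF.add hG.neg

/-- The cube is continuous from `H¹` to `L²`. -/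
theorem tendstoL2_cube {F : ℕ → Plane → ℝ} {f : Plane → ℝ} {G : ℕ → Fin 2 → Plane → ℝ}
    {g : Fin 2 → Plane → ℝ} (hFG : ∀ n, HasWeakGrad (F n) (G n)) (h : HasWeakGrad f g)
    (hF : TendstoL2 F f) (hG : ∀ i, TendstoL2 (fun n => G n i) (g i)) :
    TendstoL2 (fun n x => F n x ^ 3) (fun x => f x ^ 3) := by
  obtain ⟨K, hK0, hK⟩ := exists_integral_pow_le 1
  obtain ⟨L, hL0, hL⟩ := exists_integral_pow_le 3
  let e : ℕ → ℝ := fun n => energy (fun x => F n x - f x) (fun i x => G n i x - g i x)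
  have he : Tendsto e atTop (𝓝 0) := by
    have := tendsto_energy (hF.sub (TendstoL2.const h.memLp))
      (G := fun n i x => G n i x - g i x) (g := fun i x => g i x - g i x)
      fun i => (hG i).sub (TendstoL2.const (h.memLp_grad i))
    simpa [energy, e] using this
  have hE : Tendsto (fun n => energy (F n) (G n)) atTop (𝓝 (energy f g)) := tendsto_energy hF hG
  -- Here $(F^3-f^3)^2\le(F-f)^2\cdot8(F^4+f^4)$. By Cauchy-Schwarz and the embeddings into $L^4$
  -- and $L^8$, `b n` bounds the square of the integral, hence the square root in `hb`.
  let b : ℕ → ℝ := fun n => (K * e n ^ 2)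
    * (128 * (L * energy (F n) (G n) ^ 4 + L * energy f g ^ 4))
  have hb : Tendsto (fun n => √(b n)) atTop (𝓝 0) := by
    have h1 : Tendsto b atTop (𝓝 ((K * 0 ^ 2)
        * (128 * (L * energy f g ^ 4 + L * energy f g ^ 4)))) :=
      ((he.pow 2).const_mul K).mul ((((hE.pow 4).const_mul L).add_const _).const_mul 128)
    simpa using h1.sqrt
  refine .of_integral_sq (fun n => (hFG n).memLp_pow 2) (h.memLp_pow 2)
    (squeeze_zero (fun n => integral_nonneg fun x => sq_nonneg _) (fun n => ?_) hb)
  have hd := (hFG n).sub h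
  have hq : MemLp (fun x => 8 * (F n x ^ 4 + f x ^ 4)) 2 :=
    (((hFG n).memLp_pow 3).add (h.memLp_pow 3)).const_mul 8
  have h1 : ∫ x, (F n x ^ 3 - f x ^ 3) ^ 2
      ≤ ∫ x, (F n x - f x) ^ 2 * (8 * (F n x ^ 4 + f x ^ 4)) := by
    refine integral_mono_of_nonneg (Eventually.of_forall fun x => sq_nonneg _)
      (integrable_mul_of_memLp (hd.memLp_pow 1) hq) (Eventually.of_forall fun x => ?_)
    dsimp only
    have : (F n x ^ 3 - f x ^ 3) ^ 2
        = (F n x - f x) ^ 2 * (F n x ^ 2 + F n x * f x + f x ^ 2) ^ 2 := by ring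
    rw [this]
    refine mul_le_mul_of_nonneg_left ?_ (sq_nonneg _)
    have h3 : (F n x ^ 2 + F n x * f x + f x ^ 2) ^ 2 ≤ (2 * (F n x ^ 2 + f x ^ 2)) ^ 2 := by
      apply pow_le_pow_left₀ <;> nlinarith [sq_nonneg (F n x + f x), sq_nonneg (F n x - f x),
        sq_nonneg (F n x), sq_nonneg (f x)]
    nlinarith [sq_nonneg (F n x ^ 2 - f x ^ 2)]
  have h2 := integral_mul_sq_le (hd.memLp_pow 1) hq
  have h3 : ∫ x, ((F n x - f x) ^ (1 + 1)) ^ 2 ≤ K * e n ^ 2 := by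
    simpa only [← pow_mul] using (hK _ _ hd).2
  have h4 : ∫ x, (8 * (F n x ^ 4 + f x ^ 4)) ^ 2
      ≤ 128 * (L * energy (F n) (G n) ^ 4 + L * energy f g ^ 4) := by
    obtain ⟨i1, i2⟩ := hL _ _ (hFG n)
    obtain ⟨i3, i4⟩ := hL _ _ h
    calc _ ≤ ∫ x, 128 * (F n x ^ (2 * (3 + 1)) + f x ^ (2 * (3 + 1))) := by
          refine integral_mono hq.integrable_sq ((i1.add i3).const_mul 128) fun x => ?_
          have h8 (y : ℝ) : y ^ (2 * (3 + 1)) = (y ^ 4) ^ 2 := by ring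
          dsimp only
          rw [h8, h8]
          nlinarith [sq_nonneg (F n x ^ 4 - f x ^ 4)]
      _ ≤ _ := by
        rw [integral_const_mul, integral_add i1 i3]
        gcongr
  refine h1.trans (Real.le_sqrt_of_sq_le (h2.trans ?_))
  exact mul_le_mul h3 h4 (integral_nonneg fun x => sq_nonneg _) (by positivity)

/-! ### The localized mass identity at a fixed time. -/

theorem integral_add_add {f g h : Plane → ℝ} (hf : Integrable f) (hg : Integrable g)
    (hh : Integrable h) :
    ∫ x, (f x + g x + h x) = (∫ x, f x) + (∫ x, g x) + ∫ x, h x := by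
  rw [← integral_add hf hg, ← integral_add (f := fun x => f x + g x) (hf.add hg) hh]

theorem HasLineDerivAt.mul' {f g : Plane → ℝ} {a b : ℝ} {x v : Plane}
    (hf : HasLineDerivAt ℝ f a x v) (hg : HasLineDerivAt ℝ g b x v) :
    HasLineDerivAt ℝ (fun x => f x * g x) (a * g x + f x * b) x v := by
  have := HasDerivAt.fun_mul hf hg
  simpa [HasLineDerivAt] using this

/-- A bounded weight on the line together with its first three derivatives. -/
structure IsWeight (P : Fin 4 → ℝ → ℝ) (B : ℝ) : Prop where
  hasDerivAt : ∀ i : Fin 3, ∀ s, HasDerivAt (P i.castSucc) (P i.succ s) s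
  continuous : ∀ i, Continuous (P i)
  bound : ∀ i s, |P i s| ≤ B

theorem IsWeight.aestronglyMeasurable {P : Fin 4 → ℝ → ℝ} {B : ℝ} (h : IsWeight P B) (i : Fin 4)
    (c : ℝ) : AEStronglyMeasurable (fun x : Plane => P i (x 0 + c)) :=
  ((h.continuous i).comp (by fun_prop)).aestronglyMeasurable

theorem hasLineDerivAt_zero_of_hasDerivAt {p : ℝ → ℝ} {p' c : ℝ} {x : Plane}
    (h : HasDerivAt p p' (x 0 + c)) :
    HasLineDerivAt ℝ (fun x : Plane => p (x 0 + c)) p' x (EuclideanSpace.single 0 1) := by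
  have h1 : HasDerivAt (fun t : ℝ => x 0 + t + c) 1 0 := by
    simpa using ((hasDerivAt_id (0 : ℝ)).const_add (x 0)).add_const c
  have h2 : HasDerivAt p p' (x 0 + 0 + c) := by simpa using h
  have h3 := HasDerivAt.comp (0 : ℝ) h2 h1
  simpa [HasLineDerivAt, Function.comp_def] using h3

theorem hasLineDerivAt_one_comp (p : ℝ → ℝ) (c : ℝ) (x : Plane) :
    HasLineDerivAt ℝ (fun x : Plane => p (x 0 + c)) 0 x (EuclideanSpace.single 1 1) := by
  simpa [HasLineDerivAt] using hasDerivAt_const (0 : ℝ) (p (x 0 + c))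

theorem IsWeight.hasLineDerivAt {P : Fin 4 → ℝ → ℝ} {B : ℝ} (h : IsWeight P B) (i : Fin 3)
    (c : ℝ) (x : Plane) : HasLineDerivAt ℝ (fun x : Plane => P i.castSucc (x 0 + c))
      (P i.succ (x 0 + c)) x (EuclideanSpace.single 0 1) :=
  hasLineDerivAt_zero_of_hasDerivAt (h.hasDerivAt i _)

theorem IsWeight.integrable_mul {P : Fin 4 → ℝ → ℝ} {B : ℝ} (h : IsWeight P B) (i : Fin 4)
    (c : ℝ) {a b : Plane → ℝ} (ha : MemLp a 2) (hb : MemLp b 2) :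
    Integrable fun x => a x * b x * P i (x 0 + c) :=
  (integrable_mul_of_memLp ha hb).mul_bdd (h.aestronglyMeasurable i c)
    (Eventually.of_forall fun _ => h.bound i _)

/-- For test functions this is the vanishing of $\int\partial_1(\varphi^4P_0)$. Both sides are
continuous on $H^1$ because the cube is continuous into $L^2$, so density concludes. -/
theorem integral_cube_mul_grad {f : Plane → ℝ} {g : Fin 2 → Plane → ℝ} (h : HasWeakGrad f g)
    {P : Fin 4 → ℝ → ℝ} {B : ℝ} (hP : IsWeight P B) (c : ℝ) :
    4 * ∫ x, g 0 x * f x ^ 3 * P 0 (x 0 + c) = -∫ x, f x ^ 3 * f x * P 1 (x 0 + c) := by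
  obtain ⟨φ, hφ, hφf, hφg⟩ := h.exists_isTest_tendsto
  have hc := tendstoL2_cube (fun n => (hφ n).hasWeakGrad) h hφf hφg
  have h1 := ((hφg 0).integral_mul_mul hc (hP.aestronglyMeasurable 0 c)
    (fun x => hP.bound 0 _)).const_mul 4
  have h2 := (hc.integral_mul_mul hφf (hP.aestronglyMeasurable 1 c) (fun x => hP.bound 1 _)).neg
  refine tendsto_nhds_unique (h1.congr fun n => ?_) h2
  have i0 := hP.integrable_mul 0 c ((hφ n).memLp_partialD 0) (hφ n |>.pow three_ne_zero).memLp
  have i1 := hP.integrable_mul 1 c ((hφ n).pow three_ne_zero).memLp (hφ n).memLp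
  rw [eq_neg_iff_add_eq_zero, ← integral_const_mul, ← integral_add (i0.const_mul 4) i1]
  refine integral_lineDeriv_eq_zero (f := fun x => φ n x ^ 4 * P 0 (x 0 + c))
    (v := EuclideanSpace.single 0 1)
    (((hφ n).pow four_ne_zero).integrable.mul_bdd (hP.aestronglyMeasurable 0 c)
      (Eventually.of_forall fun _ => hP.bound 0 _)) ((i0.const_mul 4).add i1) fun x => ?_
  convert HasLineDerivAt.mul' (hasLineDerivAt_partialD ((hφ n).pow four_ne_zero).differentiable 0 x)
    (hP.hasLineDerivAt 0 c x) using 1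
  simp only [Fin.castSucc_zero]
  rw [partialD_pow (hφ n).differentiable]
  simp
  ring

/-- The right-hand side of the equation, tested against a reflected kernel. -/
theorem integral_equation_reflect {k f v : Plane → ℝ} (hk : IsTest k) (hf : MemLp f 2)
    (hv : MemLp v 2) (x : Plane) :
    ∫ y, (f y * partialD 0 (Δ fun z => k (x - z)) y + v y * partialD 0 (fun z => k (x - z)) y)
      = -(mollify (partialD 0 (partialD 0 (partialD 0 k))) f x
        + mollify (partialD 0 (partialD 1 (partialD 1 k))) f x + mollify (partialD 0 k) v x) := by
  have hk0 := hk.isTest_partialD 0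
  have hk1 := hk.isTest_partialD 1
  have hk00 := hk0.isTest_partialD 0
  have hk11 := hk1.isTest_partialD 1
  have hr (i : Fin 2) : partialD i (fun z => k (x - z)) = fun y => -partialD i k (x - y) :=
    partialD_reflect hk.differentiable i x
  have hneg (i : Fin 2) (q : Plane → ℝ) :
      partialD i (fun y => -q y) = fun y => -partialD i q y := by
    ext y; simp [partialD, fderiv_fun_neg]
  have hrr (i : Fin 2) : partialD i (partialD i fun z => k (x - z))
      = fun y => partialD i (partialD i k) (x - y) := by
    rw [hr, hneg, partialD_reflect (hk.isTest_partialD i).differentiable]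
    simp
  have hadd {q r : Plane → ℝ} (hq : Differentiable ℝ q) (hr : Differentiable ℝ r) :
      partialD 0 (fun y => q y + r y) = fun y => partialD 0 q y + partialD 0 r y := by
    ext y; simp [partialD, fderiv_fun_add (hq y) (hr y)]
  -- Second derivatives are even under the reflection; the outer first derivative contributes the
  -- sign.
  have hlap : partialD 0 (Δ fun z => k (x - z)) = fun y =>
      -partialD 0 (partialD 0 (partialD 0 k)) (x - y)
        + -partialD 0 (partialD 1 (partialD 1 k)) (x - y) := by
    rw [laplacian_eq_sum_partialD (hk.reflect x).1]
    simp only [Fin.sum_univ_two, hrr]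
    rw [hadd (hk00.reflect x).differentiable (hk11.reflect x).differentiable,
      partialD_reflect hk00.differentiable, partialD_reflect hk11.differentiable]
  rw [hlap, hr]
  have i1 := integrable_mul_of_memLp hf ((hk00.isTest_partialD 0).reflect x).memLp
  have i2 := integrable_mul_of_memLp hf ((hk11.isTest_partialD 0).reflect x).memLp
  have i3 := integrable_mul_of_memLp hv (hk0.reflect x).memLp
  simp only [mollify_apply]
  rw [← integral_add_add i1 i2 i3, ← integral_neg]
  congr 1
  ext y
  ring

/-- Integration by parts against a weight. -/
theorem IsWeight.integral_by_parts {P : Fin 4 → ℝ → ℝ} {B : ℝ} (hP : IsWeight P B) (c : ℝ)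
    (i : Fin 3) {q r q' r' : Plane → ℝ} (hq : MemLp q 2) (hr : MemLp r 2)
    (hq' : MemLp q' 2) (hr' : MemLp r' 2)
    (dq : ∀ x, HasLineDerivAt ℝ q (q' x) x (EuclideanSpace.single 0 1))
    (dr : ∀ x, HasLineDerivAt ℝ r (r' x) x (EuclideanSpace.single 0 1)) :
    (∫ x, q' x * r x * P i.castSucc (x 0 + c)) + (∫ x, q x * r' x * P i.castSucc (x 0 + c))
      + ∫ x, q x * r x * P i.succ (x 0 + c) = 0 := by
  have i1 := hP.integrable_mul i.castSucc c hq' hr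
  have i2 := hP.integrable_mul i.castSucc c hq hr'
  have i3 := hP.integrable_mul i.succ c hq hr
  rw [← integral_add_add i1 i2 i3]
  refine integral_lineDeriv_eq_zero (v := EuclideanSpace.single 0 1)
    (hP.integrable_mul i.castSucc c hq hr) ((i1.add i2).add i3) fun x => ?_
  convert HasLineDerivAt.mul' (HasLineDerivAt.mul' (dq x) (dr x)) (hP.hasLineDerivAt i c x) using 1
  ring

/-- The coordinate unit vectors. -/
noncomputable abbrev unitVec (i : Fin 2) : Plane := EuclideanSpace.single i 1

/-- The localized mass identity at a fixed time, for a function `m` with first derivatives `a, b`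
and higher derivatives `aa, ab, aaa, abb`, and a nonlinearity `h` with first derivative `h₀`. -/
theorem localizedMass_identity {P : Fin 4 → ℝ → ℝ} {B : ℝ} (hP : IsWeight P B) (c : ℝ)
    {m a b h aa ab aaa abb h₀ : Plane → ℝ}
    (Lm : MemLp m 2) (La : MemLp a 2) (Lb : MemLp b 2)
    (Lh : MemLp h 2) (Laa : MemLp aa 2) (Lab : MemLp ab 2) (Laaa : MemLp aaa 2)
    (Labb : MemLp abb 2) (Lh₀ : MemLp h₀ 2) (dm : ∀ x, HasLineDerivAt ℝ m (a x) x (unitVec 0))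
    (dm₁ : ∀ x, HasLineDerivAt ℝ m (b x) x (unitVec 1))
    (da : ∀ x, HasLineDerivAt ℝ a (aa x) x (unitVec 0))
    (daa : ∀ x, HasLineDerivAt ℝ aa (aaa x) x (unitVec 0))
    (db : ∀ x, HasLineDerivAt ℝ b (ab x) x (unitVec 0))
    (dab : ∀ x, HasLineDerivAt ℝ ab (abb x) x (unitVec 1))
    (dh : ∀ x, HasLineDerivAt ℝ h (h₀ x) x (unitVec 0)) :
    ∫ x, 2 * m x * -(aaa x + abb x + h₀ x) * P 0 (x 0 + c)
      = -3 * (∫ x, a x * a x * P 1 (x 0 + c)) - (∫ x, b x * b x * P 1 (x 0 + c))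
        + (∫ x, m x * m x * P 3 (x 0 + c)) + 2 * (∫ x, a x * h x * P 0 (x 0 + c))
        + 2 * (∫ x, m x * h x * P 1 (x 0 + c)) := by
  have I (i : Fin 4) {q r : Plane → ℝ} (hq : MemLp q 2 volume) (hr : MemLp r 2 volume) :=
    hP.integrable_mul i c hq hr
  -- Each relation is the vanishing integral of a derivative of a quadratic expression times a
  -- weight. `z7` is the only one in the second coordinate and has no weight term, because the
  -- weight depends on the first coordinate alone. Eliminating the unwanted integrals is linear
  -- algebra, done in `key`.
  have z1 := hP.integral_by_parts c 0 Lm Laa La Laaa dm daa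
  have z2 := hP.integral_by_parts c 0 La La Laa Laa da da
  have z3 := hP.integral_by_parts c 1 Lm La La Laa dm da
  have z4 := hP.integral_by_parts c 2 Lm Lm La La dm dm
  have z5 := hP.integral_by_parts c 0 Lb Lb Lab Lab db db
  have z6 := hP.integral_by_parts c 0 Lm Lh La Lh₀ dm dh
  have z7 : (∫ x, b x * ab x * P 0 (x 0 + c)) + ∫ x, m x * abb x * P 0 (x 0 + c) = 0 := by
    rw [← integral_add (I 0 Lb Lab) (I 0 Lm Labb)]
    refine integral_lineDeriv_eq_zero (v := EuclideanSpace.single 1 1) (I 0 Lm Lab)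
      ((I 0 Lb Lab).add (I 0 Lm Labb)) fun x => ?_
    convert HasLineDerivAt.mul' (HasLineDerivAt.mul' (dm₁ x) (dab x))
      (hasLineDerivAt_one_comp (P 0) c x) using 1
    ring
  have hL : ∫ x, 2 * m x * -(aaa x + abb x + h₀ x) * P 0 (x 0 + c)
      = -2 * ((∫ x, m x * aaa x * P 0 (x 0 + c)) + (∫ x, m x * abb x * P 0 (x 0 + c))
        + ∫ x, m x * h₀ x * P 0 (x 0 + c)) := by
    rw [← integral_add_add (I 0 Lm Laaa) (I 0 Lm Labb) (I 0 Lm Lh₀), ← integral_const_mul]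
    congr 1
    ext x
    ring
  have comm (q r : Plane → ℝ) (i : Fin 4) : ∫ x, q x * r x * P i (x 0 + c)
      = ∫ x, r x * q x * P i (x 0 + c) := by simp_rw [mul_comm (q _)]
  have key {A B C D E F G H J K L N : ℝ} (z1 : A + B + C = 0) (z2 : A + A + D = 0)
      (z3 : D + C + E = 0) (z4 : E + E + F = 0) (z5 : G + G + H = 0) (z6 : J + K + L = 0)
      (z7 : G + N = 0) : -2 * (B + N + K) = -3 * D - H + F + 2 * J + 2 * L := by linarith
  rw [comm aa a] at z2
  rw [comm a m] at z4
  rw [comm ab b] at z5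
  exact hL.trans (key z1 z2 z3 z4 z5 z6 z7)

/-- The localized mass identity for a mollified function at a fixed time. -/
theorem integral_mollify_equation {k f v : Plane → ℝ} (hk : IsTest k) (hf : MemLp f 2)
    (hv : MemLp v 2) {P : Fin 4 → ℝ → ℝ} {B : ℝ} (hP : IsWeight P B) (c : ℝ) :
    ∫ x, 2 * mollify k f x * (∫ y, (f y * partialD 0 (Δ fun z => k (x - z)) y
        + v y * partialD 0 (fun z => k (x - z)) y)) * P 0 (x 0 + c)
      = -3 * (∫ x, mollify (partialD 0 k) f x * mollify (partialD 0 k) f x * P 1 (x 0 + c))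
        - (∫ x, mollify (partialD 1 k) f x * mollify (partialD 1 k) f x * P 1 (x 0 + c))
        + (∫ x, mollify k f x * mollify k f x * P 3 (x 0 + c))
        + 2 * (∫ x, mollify (partialD 0 k) f x * mollify k v x * P 0 (x 0 + c))
        + 2 * (∫ x, mollify k f x * mollify k v x * P 1 (x 0 + c)) := by
  have hk0 := hk.isTest_partialD 0
  have hk1 := hk.isTest_partialD 1
  have hk00 := hk0.isTest_partialD 0
  have hk01 := hk1.isTest_partialD 0
  have hk11 := hk1.isTest_partialD 1
  have hfl : LocallyIntegrable f := hf.locallyIntegrable (by norm_num)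
  have hvl : LocallyIntegrable v := hv.locallyIntegrable (by norm_num)
  simp_rw [integral_equation_reflect hk hf hv]
  exact localizedMass_identity hP c (memLp_mollify hk hf) (memLp_mollify hk0 hf)
    (memLp_mollify hk1 hf) (memLp_mollify hk hv) (memLp_mollify hk00 hf) (memLp_mollify hk01 hf)
    (memLp_mollify (hk00.isTest_partialD 0) hf) (memLp_mollify (hk11.isTest_partialD 0) hf)
    (memLp_mollify hk0 hv) (hasLineDerivAt_mollify hk hfl 0) (hasLineDerivAt_mollify hk hfl 1)
    (hasLineDerivAt_mollify hk0 hfl 0) (hasLineDerivAt_mollify hk00 hfl 0)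
    (hasLineDerivAt_mollify hk1 hfl 0)
    -- The $x_2$-derivative has to be commuted past the $x_1$-derivative to match the term coming
    -- from the Laplacian.
    (fun x => by simpa only [partialD_comm hk1.1 1 0] using hasLineDerivAt_mollify hk01 hfl 1 x)
    (hasLineDerivAt_mollify hk hvl 0)

/-! ### Evolution of the mass of a mollified solution. -/

theorem norm_sq_lp {E : Type*} [NormedAddCommGroup E] [InnerProductSpace ℝ E]
    (f : Lp E 2 (volume : Measure Plane)) : ‖f‖ ^ 2 = ∫ x, ‖f x‖ ^ 2 := by
  rw [← real_inner_self_eq_norm_sq, L2.inner_def]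
  simp_rw [real_inner_self_eq_norm_sq]

theorem H1.energy_eq (p : H1) : energy p (fun i x => p.1.snd x i) = ‖p‖ ^ 2 := by
  have h : ‖p‖ ^ 2 = ‖p.1.fst‖ ^ 2 + ‖p.1.snd‖ ^ 2 := by
    rw [Submodule.coe_norm, WithLp.prod_norm_sq_eq_of_L2]
  rw [h, norm_sq_lp, norm_sq_lp, energy]
  have i2 : Integrable fun x => ‖p.1.snd x‖ ^ 2 := (Lp.memLp p.1.snd).integrable_norm_pow (by simp)
  have i1 : Integrable fun x => ‖p.1.fst x‖ ^ 2 := (Lp.memLp p.1.fst).integrable_norm_pow (by simp)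
  rw [← integral_add i1 i2]
  congr 1
  ext x
  rw [EuclideanSpace.norm_sq_eq]
  simp

theorem integral_sq_eq_eLpNorm {q : Plane → ℝ} (hq : MemLp q 2) :
    ∫ x, q x ^ 2 = (eLpNorm q 2).toReal ^ 2 := by
  rw [← ENNReal.toReal_pow, eLpNorm_two_sq, integral_eq_lintegral_of_nonneg_ae
    (Eventually.of_forall fun x => sq_nonneg _) (hq.1.pow 2)]
  congr 1
  refine lintegral_congr fun x => ?_
  rw [← sq_abs, ENNReal.ofReal_pow (abs_nonneg _), ← Real.enorm_eq_ofReal_abs]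

theorem exists_integral_mollify_sq_le {k : Plane → ℝ} (hk : IsTest k) : ∃ C : ℝ, 0 ≤ C ∧
    ∀ f, MemLp f 2 → ∫ x, mollify k f x ^ 2 ≤ C * ∫ x, f x ^ 2 := by
  have hk1 : eLpNorm k 1 ≠ ⊤ := (memLp_one_iff_integrable.2 hk.integrable).2.ne
  refine ⟨(eLpNorm k 1).toReal ^ 2, by positivity, fun f hf => ?_⟩
  rw [integral_sq_eq_eLpNorm hf, integral_sq_eq_eLpNorm (memLp_mollify hk hf), ← mul_pow,
      ← ENNReal.toReal_mul]
  gcongr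
  · exact ENNReal.mul_ne_top hk1 hf.2.ne
  · exact eLpNorm_mollify_le hk hf

theorem integral_mollify_molli_sq_le (n : ℕ) {f : Plane → ℝ} (hf : MemLp f 2) :
    ∫ x, mollify (molli n) f x ^ 2 ≤ ∫ x, f x ^ 2 := by
  rw [integral_sq_eq_eLpNorm hf, integral_sq_eq_eLpNorm (memLp_mollify (isTest_molli n) hf)]
  gcongr
  · exact hf.2.ne
  · exact eLpNorm_mollify_molli_le n hf

/-- Continuous in `x` for fixed `f`, and Lipschitz in `f` with constant $\|k\|_2$ uniformly in `x`.
Joint continuity will make the time derivative of the mollified solution jointly measurable. -/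
theorem continuous_mollify_lp {k : Plane → ℝ} (hk : IsTest k) :
    Continuous fun q : Lp ℝ 2 (volume : Measure Plane) × Plane => mollify k q.1 q.2 := by
  have hin (f : Lp ℝ 2 (volume : Measure Plane)) (x : Plane) :
      mollify k f x = inner ℝ ((hk.reflect x).memLp.toLp _) f := by
    rw [mollify_apply, L2.inner_def]
    refine integral_congr_ae ?_
    filter_upwards [(hk.reflect x).memLp.coeFn_toLp] with y hy
    simp [hy]
  refine continuous_prod_of_continuous_lipschitzWith _ (eLpNorm k 2).toNNReal (fun f => ?_)
    fun x => ?_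
  · exact (contDiff_mollify hk ((Lp.memLp f).locallyIntegrable (by norm_num))).continuous
  · refine LipschitzWith.of_dist_le_mul fun f g => ?_
    dsimp only
    rw [hin, hin, Real.dist_eq, ← inner_sub_right, dist_eq_norm]
    refine (abs_real_inner_le_norm _ _).trans_eq ?_
    congr 1
    rw [Lp.norm_toLp]
    congr 1
    exact eLpNorm_comp_measurePreserving (g := k) hk.continuous.aestronglyMeasurable
      (Measure.measurePreserving_sub_left volume x)

/-- The time derivative of the localized mass of a solution with value `m`, derivatives `a, b` and
nonlinearity `h`, for the weight `P 0` translated by `c` and moving at speed `1 / 2`. -/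
noncomputable def massRate (P : Fin 4 → ℝ → ℝ) (c : ℝ) (m a b h : Plane → ℝ) : ℝ :=
  -3 * (∫ x, a x * a x * P 1 (x 0 + c)) - (∫ x, b x * b x * P 1 (x 0 + c))
    + (∫ x, m x * m x * P 3 (x 0 + c)) + 2 * (∫ x, a x * h x * P 0 (x 0 + c))
    + 2 * (∫ x, m x * h x * P 1 (x 0 + c)) - 1 / 2 * ∫ x, m x * m x * P 1 (x 0 + c)

/-- The fundamental theorem of calculus for integrals over the plane depending on time. -/
theorem integral_sub_eq_setIntegral_integral {f f' : ℝ → Plane → ℝ} {t₁ t₂ M : ℝ} (h12 : t₁ ≤ t₂)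
    (hm : Measurable (Function.uncurry f')) (hi : ∀ s ∈ Ioc t₁ t₂, Integrable (f' s))
    (hM : ∀ s ∈ Ioc t₁ t₂, ∫ x, ‖f' s x‖ ≤ M) (h₁ : Integrable (f t₁)) (h₂ : Integrable (f t₂))
    (hc : ∀ x, Continuous fun s => f s x)
    (hd : ∀ s ∈ Ioc t₁ t₂, ∀ x, HasDerivAt (fun s => f s x) (f' s x) s) :
    IntegrableOn (fun s => ∫ x, f' s x) (Ioc t₁ t₂) ∧
      (∫ x, f t₂ x) - (∫ x, f t₁ x) = ∫ s in Ioc t₁ t₂, ∫ x, f' s x := by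
  have hint : Integrable (Function.uncurry f') ((volume.restrict (Ioc t₁ t₂)).prod volume) := by
    rw [integrable_prod_iff hm.aestronglyMeasurable]
    refine ⟨(ae_restrict_iff' measurableSet_Ioc).2 (Eventually.of_forall hi),
      Measure.integrableOn_of_bounded (M := M) (by simp)
        hm.norm.stronglyMeasurable.integral_prod_right.aestronglyMeasurable
        ((ae_restrict_iff' measurableSet_Ioc).2 (Eventually.of_forall fun s hs => ?_))⟩
    rw [Real.norm_of_nonneg (integral_nonneg fun x => norm_nonneg _)]
    exact hM s hs
  -- Fubini gives integrability in time for almost every `x`. This version of the fundamental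
  -- theorem asks for the derivative only in the open interval, so `t₁ = 0` is allowed.
  have hftc : ∀ᵐ x : Plane, ∫ s in Ioc t₁ t₂, f' s x = f t₂ x - f t₁ x := by
    filter_upwards [hint.prod_left_ae] with x hx
    rw [← intervalIntegral.integral_of_le h12]
    exact intervalIntegral.integral_eq_sub_of_hasDerivAt_of_le h12 (hc x).continuousOn
      (fun s hs => hd s ⟨hs.1, hs.2.le⟩ x)
      ((intervalIntegrable_iff_integrableOn_Ioc_of_le h12).2 hx)
  refine ⟨hint.integral_prod_left, ?_⟩
  rw [← integral_sub h₂ h₁, ← integral_congr_ae hftc, ← integral_integral_swap hint]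

theorem memLp_equation_reflect {k f v : Plane → ℝ} (hk : IsTest k) (hf : MemLp f 2)
    (hv : MemLp v 2) : MemLp (fun x => ∫ y, (f y * partialD 0 (Δ fun z => k (x - z)) y
      + v y * partialD 0 (fun z => k (x - z)) y)) 2 := by
  have hk0 := hk.isTest_partialD 0
  have hk1 := hk.isTest_partialD 1
  simp_rw [integral_equation_reflect hk hf hv]
  exact (((memLp_mollify ((hk0.isTest_partialD 0).isTest_partialD 0) hf).add
    (memLp_mollify ((hk1.isTest_partialD 1).isTest_partialD 0) hf)).add (memLp_mollify hk0 hv)).neg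

theorem exists_integral_equation_sq_le {k : Plane → ℝ} (hk : IsTest k) : ∃ C : ℝ, 0 ≤ C ∧
    ∀ f v, MemLp f 2 → MemLp v 2 →
      ∫ x, (∫ y, (f y * partialD 0 (Δ fun z => k (x - z)) y
        + v y * partialD 0 (fun z => k (x - z)) y)) ^ 2 ≤ C * ((∫ x, f x ^ 2) + ∫ x, v x ^ 2) := by
  have hk0 := hk.isTest_partialD 0
  have hk000 := (hk0.isTest_partialD 0).isTest_partialD 0
  have hk011 := ((hk.isTest_partialD 1).isTest_partialD 1).isTest_partialD 0
  obtain ⟨C₁, hC₁0, hC₁⟩ := exists_integral_mollify_sq_le hk000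
  obtain ⟨C₂, hC₂0, hC₂⟩ := exists_integral_mollify_sq_le hk011
  obtain ⟨C₃, hC₃0, hC₃⟩ := exists_integral_mollify_sq_le hk0
  refine ⟨3 * (C₁ + C₂ + C₃), by positivity, fun f v hf hv => ?_⟩
  have i1 := (memLp_mollify hk000 hf).integrable_sq
  have i2 := (memLp_mollify hk011 hf).integrable_sq
  have i3 := (memLp_mollify hk0 hv).integrable_sq
  have hle : ∫ x, (∫ y, (f y * partialD 0 (Δ fun z => k (x - z)) y
      + v y * partialD 0 (fun z => k (x - z)) y)) ^ 2
      ≤ ∫ x, 3 * (mollify (partialD 0 (partialD 0 (partialD 0 k))) f x ^ 2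
        + mollify (partialD 0 (partialD 1 (partialD 1 k))) f x ^ 2
        + mollify (partialD 0 k) v x ^ 2) := by
    refine integral_mono (memLp_equation_reflect hk hf hv).integrable_sq
      (((i1.add i2).add i3).const_mul 3) fun x => ?_
    have key (x₁ x₂ x₃ : ℝ) : (-(x₁ + x₂ + x₃)) ^ 2 ≤ 3 * (x₁ ^ 2 + x₂ ^ 2 + x₃ ^ 2) := by
      nlinarith [sq_nonneg (x₁ - x₂), sq_nonneg (x₁ - x₃), sq_nonneg (x₂ - x₃)]
    dsimp only
    rw [integral_equation_reflect hk hf hv]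
    exact key _ _ _
  refine hle.trans ?_
  rw [integral_const_mul, integral_add_add i1 i2 i3]
  have j1 := hC₁ _ hf
  have j2 := hC₂ _ hf
  have j3 := hC₃ _ hv
  have n1 : 0 ≤ ∫ x, f x ^ 2 := integral_nonneg fun x => sq_nonneg _
  have n2 : 0 ≤ ∫ x, v x ^ 2 := integral_nonneg fun x => sq_nonneg _
  nlinarith [mul_nonneg hC₁0 n2, mul_nonneg hC₂0 n2, mul_nonneg hC₃0 n1]

/-- With `D` the time derivative of `m`, the integrand is the time derivative of the mass density,
the second term being due to the moving weight. A bound depending only on $L^2$ norms is uniform in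
time and justifies Fubini. -/
theorem integral_norm_massDensity_le {P : Fin 4 → ℝ → ℝ} {B : ℝ} (hP : IsWeight P B) (c : ℝ)
    {m D : Plane → ℝ} (hm : MemLp m 2) (hD : MemLp D 2) :
    Integrable (fun x => 2 * m x * D x * P 0 (x 0 + c)) ∧
    Integrable (fun x => 1 / 2 * (m x * m x * P 1 (x 0 + c))) ∧
    ∫ x, ‖2 * m x * D x * P 0 (x 0 + c) - 1 / 2 * (m x * m x * P 1 (x 0 + c))‖
      ≤ B * (2 * (∫ x, m x ^ 2) + ∫ x, D x ^ 2) := by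
  have hB0 : 0 ≤ B := (abs_nonneg _).trans (hP.bound 0 0)
  have i1 : Integrable fun x => 2 * m x * D x * P 0 (x 0 + c) := by
    simpa only [mul_assoc] using (hP.integrable_mul 0 c hm hD).const_mul 2
  have i2 : Integrable fun x => 1 / 2 * (m x * m x * P 1 (x 0 + c)) :=
    (hP.integrable_mul 1 c hm hm).const_mul (1 / 2)
  refine ⟨i1, i2, ?_⟩
  have j1 := hm.integrable_sq
  have j2 := hD.integrable_sq
  have hle : ∫ x, ‖2 * m x * D x * P 0 (x 0 + c) - 1 / 2 * (m x * m x * P 1 (x 0 + c))‖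
      ≤ ∫ x, B * (2 * m x ^ 2 + D x ^ 2) := by
    refine integral_mono (i1.sub i2).norm (((j1.const_mul 2).add j2).const_mul B) fun x => ?_
    have key {y z p p' : ℝ} (b0 : |p| ≤ B) (b1 : |p'| ≤ B) :
        |2 * y * z * p - 1 / 2 * (y * y * p')| ≤ B * (2 * y ^ 2 + z ^ 2) := by
      have e1 : |2 * y * z| ≤ y ^ 2 + z ^ 2 := by
        rw [abs_le]
        constructor <;> nlinarith [sq_nonneg (y - z), sq_nonneg (y + z)]
      calc |2 * y * z * p - 1 / 2 * (y * y * p')|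
          ≤ |2 * y * z * p| + |1 / 2 * (y * y * p')| := abs_sub _ _
        _ = |2 * y * z| * |p| + 1 / 2 * (y ^ 2 * |p'|) := by
          rw [abs_mul, abs_mul (1 / 2), abs_mul (y * y), ← sq, abs_of_nonneg (sq_nonneg y)]
          norm_num
        _ ≤ (y ^ 2 + z ^ 2) * B + 1 / 2 * (y ^ 2 * B) := by gcongr
        _ ≤ _ := by nlinarith [mul_nonneg hB0 (sq_nonneg y)]
    exact key (hP.bound 0 _) (hP.bound 1 _)
  rwa [integral_const_mul, integral_add (j1.const_mul 2) j2, integral_const_mul] at hle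

/-- Continuity on a compact time interval bounds the $H^1$ norm; the embedding into $L^6$ then
bounds the cube. -/
theorem exists_uniform_bound {u : ℝ → H1} (hu : ContinuousOn u (Ici 0)) {t₁ : ℝ} (h0 : 0 ≤ t₁)
    (t₂ : ℝ) : ∃ R : ℝ, 0 ≤ R ∧ ∀ s ∈ Icc t₁ t₂,
      ‖u s‖ ^ 2 ≤ R ∧ (∫ x, u s x ^ 2) ≤ R ∧ (∫ x, (u s x ^ 3) ^ 2) ≤ R := by
  obtain ⟨R, hR⟩ := (isCompact_Icc (a := t₁) (b := t₂)).exists_bound_of_continuousOn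
    (f := fun s => ‖u s‖ ^ 2) ((hu.mono fun s hs => h0.trans hs.1).norm.pow 2)
  obtain ⟨K, hK0, hK⟩ := exists_integral_pow_le 2
  refine ⟨|R| + K * |R| ^ 3, by positivity, fun s hs => ?_⟩
  have h1 : ‖u s‖ ^ 2 ≤ |R| := by
    have := hR s hs
    rw [Real.norm_of_nonneg (by positivity)] at this
    exact this.trans (le_abs_self R)
  have hK' : 0 ≤ K * |R| ^ 3 := by positivity
  have h2 : ∫ x, u s x ^ 2 ≤ ‖u s‖ ^ 2 :=
    (H1.hasWeakGrad (u s)).integral_sq_le_energy.trans_eq (H1.energy_eq (u s))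
  have h3 : ∫ x, (u s x ^ 3) ^ 2 ≤ K * |R| ^ 3 := by
    have := (hK _ _ (H1.hasWeakGrad (u s))).2
    rw [H1.energy_eq (u s)] at this
    simp_rw [← pow_mul]
    refine this.trans ?_
    gcongr
  exact ⟨by linarith, by linarith, by linarith [abs_nonneg R]⟩

/-- The mass identity for the mollification of a solution. -/
theorem IsSolution.mollified_mass {u : ℝ → H1} (hu : IsSolution u) {P : Fin 4 → ℝ → ℝ} {B : ℝ}
    (hP : IsWeight P B) (a : ℝ) {t₁ t₂ : ℝ} (h0 : 0 ≤ t₁) (h12 : t₁ ≤ t₂) {k : Plane → ℝ}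
    (hk : IsTest k) :
    let G : ℝ → ℝ := fun s => massRate P (a - s / 2) (mollify k (u s))
      (mollify (partialD 0 k) (u s)) (mollify (partialD 1 k) (u s)) (mollify k fun x => u s x ^ 3)
    IntegrableOn G (Ioc t₁ t₂) ∧
    (∫ x, mollify k (u t₂) x * mollify k (u t₂) x * P 0 (x 0 + (a - t₂ / 2)))
      - (∫ x, mollify k (u t₁) x * mollify k (u t₁) x * P 0 (x 0 + (a - t₁ / 2)))
      = ∫ s in Ioc t₁ t₂, G s := by
  intro G
  -- Freezing the solution at negative times makes it continuous on the whole line.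
  let U : ℝ → H1 := fun s => u (max s 0)
  have hU : Continuous U :=
    hu.continuousOn.comp_continuous (by fun_prop) fun s => le_max_right s 0
  have hUu {s : ℝ} (hs : 0 ≤ s) : U s = u s := by simp only [U, max_eq_left hs]
  let m : ℝ → Plane → ℝ := fun s x => mollify k (U s) x
  have hUL : Continuous fun s => (U s).1.fst :=
    (WithLp.prod_continuous_ofLp 2 _ _).fst.comp (continuous_subtype_val.comp hU)
  have hmc : Continuous (Function.uncurry fun x s => m s x) :=
    (continuous_mollify_lp hk).comp ((hUL.comp continuous_snd).prodMk continuous_fst)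
  -- Taking `deriv` as the definition yields joint measurability from joint continuity of `m`; `hD`
  -- identifies it for positive times.
  let D : ℝ → Plane → ℝ := fun s x => deriv (fun s => m s x) s
  have hDm : Measurable fun q : ℝ × Plane => D q.1 q.2 :=
    (measurable_deriv_with_param hmc).comp measurable_swap
  have hD {s : ℝ} (hs : 0 < s) (x : Plane) : HasDerivAt (fun s => m s x)
      (∫ y, (u s y * partialD 0 (Δ fun z => k (x - z)) y
        + u s y ^ 3 * partialD 0 (fun z => k (x - z)) y)) s := by
    refine (hu.equation _ (hk.reflect x) s hs).congr_of_eventuallyEq ?_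
    filter_upwards [lt_mem_nhds hs] with r hr
    simp only [m, hUu hr.le]
    rfl
  let f' : ℝ → Plane → ℝ := fun s x => 2 * m s x * D s x * P 0 (x 0 + (a - s / 2))
    - 1 / 2 * (m s x * m s x * P 1 (x 0 + (a - s / 2)))
  have hpc (i : Fin 4) : Continuous fun q : ℝ × Plane => P i (q.2 0 + (a - q.1 / 2)) :=
    (hP.continuous i).comp (by fun_prop)
  have hmc' : Continuous fun q : ℝ × Plane => m q.1 q.2 := hmc.comp continuous_swap
  have hf'm : Measurable (Function.uncurry f') :=
    ((((hmc'.measurable.const_mul 2).mul hDm).mul (hpc 0).measurable).sub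
      (((hmc'.measurable.mul hmc'.measurable).mul (hpc 1).measurable).const_mul (1 / 2)))
  obtain ⟨R, hR0, hR⟩ := exists_uniform_bound hu.continuousOn h0 t₂
  obtain ⟨C₁, hC₁0, hC₁⟩ := exists_integral_mollify_sq_le hk
  obtain ⟨C₂, hC₂0, hC₂⟩ := exists_integral_equation_sq_le hk
  have hL (s : ℝ) : MemLp (u s) 2 := (H1.hasWeakGrad (u s)).memLp
  have hV (s : ℝ) : MemLp (fun x => u s x ^ 3) 2 := (H1.hasWeakGrad (u s)).memLp_pow 2
  have hmL {s : ℝ} (hs : 0 ≤ s) : MemLp (m s) 2 := by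
    simp only [m, hUu hs]; exact memLp_mollify hk (hL s)
  have hDf {s : ℝ} (hs : 0 < s) : D s = fun x => ∫ y, (u s y * partialD 0 (Δ fun z => k (x - z)) y
        + u s y ^ 3 * partialD 0 (fun z => k (x - z)) y) := funext fun x => (hD hs x).deriv
  have hDL {s : ℝ} (hs : 0 < s) : MemLp (D s) 2 := by
    rw [hDf hs]
    exact memLp_equation_reflect hk (hL s) (hV s)
  have hdens {s : ℝ} (hs : 0 < s) :=
    integral_norm_massDensity_le hP (a - s / 2) (hmL hs.le) (hDL hs)
  have hG {s : ℝ} (hs : s ∈ Ioc t₁ t₂) : ∫ x, f' s x = G s := by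
    have hs0 : 0 < s := h0.trans_lt hs.1
    have h1 := integral_mollify_equation hk (hL s) (hV s) hP (a - s / 2)
    simp only [f']
    rw [integral_sub (hdens hs0).1 (hdens hs0).2.1, integral_const_mul]
    simp_rw [hDf hs0, m, hUu hs0.le]
    rw [h1]
    rfl
  have hM : ∀ s ∈ Ioc t₁ t₂, ∫ x, ‖f' s x‖ ≤ B * (2 * (C₁ * R) + C₂ * (R + R)) := by
    intro s hs
    have hs0 : 0 < s := h0.trans_lt hs.1
    have hB0 : 0 ≤ B := (abs_nonneg _).trans (hP.bound 0 0)
    obtain ⟨-, b1, b2⟩ := hR s ⟨hs.1.le, hs.2⟩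
    refine (hdens hs0).2.2.trans ?_
    rw [hDf hs0]
    simp only [m, hUu hs0.le]
    gcongr
    · exact (hC₁ _ (hL s)).trans (by gcongr)
    · exact (hC₂ _ _ (hL s) (hV s)).trans (by gcongr)
  have hc (x : Plane) : Continuous fun s => m s x * m s x * P 0 (x 0 + (a - s / 2)) := by
    have hmx : Continuous fun s => m s x := hmc'.comp (continuous_id.prodMk continuous_const)
    exact (hmx.mul hmx).mul ((hpc 0).comp (continuous_id.prodMk continuous_const))
  have hd : ∀ s ∈ Ioc t₁ t₂, ∀ x : Plane,
      HasDerivAt (fun s => m s x * m s x * P 0 (x 0 + (a - s / 2))) (f' s x) s := by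
    intro s hs x
    have hs0 : 0 < s := h0.trans_lt hs.1
    have d1 : HasDerivAt (fun s => m s x) (D s x) s := (hD hs0 x).differentiableAt.hasDerivAt
    have d2 : HasDerivAt (fun s => x 0 + (a - s / 2)) (-(1 / 2)) s := by
      simpa using (((hasDerivAt_id s).div_const 2).const_sub a).const_add (x 0)
    have d3 : HasDerivAt (fun s => P 0 (x 0 + (a - s / 2)))
        (P 1 (x 0 + (a - s / 2)) * -(1 / 2)) s :=
      HasDerivAt.comp s (hP.hasDerivAt 0 (x 0 + (a - s / 2))) d2
    refine ((d1.fun_mul d1).fun_mul d3).congr_deriv ?_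
    simp only [f']
    ring
  obtain ⟨r1, r2⟩ := integral_sub_eq_setIntegral_integral
    (f := fun s x => m s x * m s x * P 0 (x 0 + (a - s / 2))) h12 hf'm
    (fun s hs => (hdens (h0.trans_lt hs.1)).1.sub (hdens (h0.trans_lt hs.1)).2.1) hM
    (hP.integrable_mul 0 _ (hmL h0) (hmL h0))
    (hP.integrable_mul 0 _ (hmL (h0.trans h12)) (hmL (h0.trans h12))) hc hd
  refine ⟨r1.congr_fun (fun s hs => hG hs) measurableSet_Ioc, ?_⟩
  rw [← setIntegral_congr_fun measurableSet_Ioc fun s hs => hG hs, ← r2]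
  simp only [m, hUu h0, hUu (h0.trans h12)]

/-! ### Removal of the mollification. -/

/-- The nonlinear terms combine: $2\int u_{x_1}u^3P_0=-\frac12\int u^4P_1$, and adding $2\int
u^4P_1$ leaves the coefficient $\frac32$. -/
theorem massRate_eq {f : Plane → ℝ} {g : Fin 2 → Plane → ℝ} (h : HasWeakGrad f g)
    {P : Fin 4 → ℝ → ℝ} {B : ℝ} (hP : IsWeight P B) (c : ℝ) :
    massRate P c f (g 0) (g 1) (fun x => f x ^ 3)
      = -3 * (∫ x, g 0 x * g 0 x * P 1 (x 0 + c)) - (∫ x, g 1 x * g 1 x * P 1 (x 0 + c))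
        + (∫ x, f x * f x * P 3 (x 0 + c)) + 3 / 2 * (∫ x, f x ^ 4 * P 1 (x 0 + c))
        - 1 / 2 * ∫ x, f x * f x * P 1 (x 0 + c) := by
  have h1 := integral_cube_mul_grad h hP c
  have e1 : ∫ x, f x ^ 3 * f x * P 1 (x 0 + c) = ∫ x, f x ^ 4 * P 1 (x 0 + c) := by
    simp_rw [← pow_succ]
  have e2 : ∫ x, f x * f x ^ 3 * P 1 (x 0 + c) = ∫ x, f x ^ 4 * P 1 (x 0 + c) := by
    simp_rw [← pow_succ']
  rw [massRate, e2]
  rw [e1] at h1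
  linarith

theorem tendsto_massRate {P : Fin 4 → ℝ → ℝ} {B : ℝ} (hP : IsWeight P B) (c : ℝ)
    {M A E H : ℕ → Plane → ℝ} {m a b h : Plane → ℝ} (hM : TendstoL2 M m) (hA : TendstoL2 A a)
    (hE : TendstoL2 E b) (hH : TendstoL2 H h) :
    Tendsto (fun n => massRate P c (M n) (A n) (E n) (H n)) atTop (𝓝 (massRate P c m a b h)) := by
  have T (i : Fin 4) {F G : ℕ → Plane → ℝ} {f g : Plane → ℝ} (hF : TendstoL2 F f)
      (hG : TendstoL2 G g) : Tendsto (fun n => ∫ x, F n x * G n x * P i (x 0 + c)) atTop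
        (𝓝 (∫ x, f x * g x * P i (x 0 + c))) :=
    hF.integral_mul_mul hG (hP.aestronglyMeasurable i c) fun x => hP.bound i _
  exact ((((((T 1 hA hA).const_mul (-3)).sub (T 1 hE hE)).add (T 3 hM hM)).add
    ((T 0 hA hH).const_mul 2)).add ((T 1 hM hH).const_mul 2)).sub ((T 1 hM hM).const_mul (1 / 2))

theorem HasWeakGrad.tendsto_massRate_mollify {f : Plane → ℝ} {g : Fin 2 → Plane → ℝ}
    (h : HasWeakGrad f g) {P : Fin 4 → ℝ → ℝ} {B : ℝ} (hP : IsWeight P B) (c : ℝ) :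
    Tendsto (fun n => massRate P c (mollify (molli n) f) (mollify (partialD 0 (molli n)) f)
      (mollify (partialD 1 (molli n)) f) (mollify (molli n) fun x => f x ^ 3)) atTop
      (𝓝 (massRate P c f (g 0) (g 1) fun x => f x ^ 3)) := by
  simp_rw [h.mollify_partialD (isTest_molli _)]
  exact tendsto_massRate hP c (tendstoL2_mollify h.memLp) (tendstoL2_mollify (h.memLp_grad 0))
    (tendstoL2_mollify (h.memLp_grad 1)) (tendstoL2_mollify (h.memLp_pow 2))

theorem IsWeight.abs_integral_mul_le {P : Fin 4 → ℝ → ℝ} {B : ℝ} (hP : IsWeight P B) (i : Fin 4)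
    (c : ℝ) {a b : Plane → ℝ} (ha : MemLp a 2) (hb : MemLp b 2) :
    |∫ x, a x * b x * P i (x 0 + c)| ≤ B * ((∫ x, a x ^ 2) + ∫ x, b x ^ 2) := by
  have hB0 : 0 ≤ B := (abs_nonneg _).trans (hP.bound 0 0)
  rw [← integral_add ha.integrable_sq hb.integrable_sq, ← integral_const_mul,
    ← Real.norm_eq_abs]
  refine norm_integral_le_of_norm_le ((ha.integrable_sq.add hb.integrable_sq).const_mul B)
    (Eventually.of_forall fun x => ?_)
  rw [Real.norm_eq_abs, abs_mul, mul_comm]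
  have h1 : |a x * b x| ≤ a x ^ 2 + b x ^ 2 := by
    rw [abs_le]
    constructor <;> nlinarith [sq_nonneg (a x - b x), sq_nonneg (a x + b x)]
  exact mul_le_mul (hP.bound i _) h1 (abs_nonneg _) hB0

theorem abs_massRate_le {P : Fin 4 → ℝ → ℝ} {B R : ℝ} (hP : IsWeight P B) (c : ℝ)
    {m a b h : Plane → ℝ} (hm : MemLp m 2) (ha : MemLp a 2) (hb : MemLp b 2) (hh : MemLp h 2)
    (hmR : ∫ x, m x ^ 2 ≤ R) (haR : ∫ x, a x ^ 2 ≤ R) (hbR : ∫ x, b x ^ 2 ≤ R)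
    (hhR : ∫ x, h x ^ 2 ≤ R) : |massRate P c m a b h| ≤ 20 * (B * R) := by
  have hB0 : 0 ≤ B := (abs_nonneg _).trans (hP.bound 0 0)
  have key (i : Fin 4) {p q : Plane → ℝ} (hp : MemLp p 2 volume) (hq : MemLp q 2 volume)
      (hpR : ∫ x, p x ^ 2 ≤ R) (hqR : ∫ x, q x ^ 2 ≤ R) :
      |∫ x, p x * q x * P i (x 0 + c)| ≤ 2 * (B * R) := by
    refine (hP.abs_integral_mul_le i c hp hq).trans ?_
    have := mul_le_mul_of_nonneg_left (add_le_add hpR hqR) hB0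
    linarith
  have k1 := abs_le.1 (key 1 ha ha haR haR)
  have k2 := abs_le.1 (key 1 hb hb hbR hbR)
  have k3 := abs_le.1 (key 3 hm hm hmR hmR)
  have k4 := abs_le.1 (key 0 ha hh haR hhR)
  have k5 := abs_le.1 (key 1 hm hh hmR hhR)
  have k6 := abs_le.1 (key 1 hm hm hmR hmR)
  rw [massRate, abs_le]
  -- The coefficients in `massRate` have absolute sum $\frac{19}2$, and each integral is at most `2
  -- * (B * R)`.
  constructor <;> linarith [k1.1, k1.2, k2.1, k2.2, k3.1, k3.2, k4.1, k4.2, k5.1, k5.2, k6.1, k6.2]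

theorem HasWeakGrad.integral_grad_le_energy {f : Plane → ℝ} {g : Fin 2 → Plane → ℝ}
    (h : HasWeakGrad f g) (i : Fin 2) : ∫ x, g i x ^ 2 ≤ energy f g := by
  refine integral_mono (h.memLp_grad i).integrable_sq h.integrable_energy fun x => ?_
  have : g i x ^ 2 ≤ ∑ i, g i x ^ 2 :=
    Finset.single_le_sum (f := fun i => g i x ^ 2) (fun i _ => sq_nonneg _) (Finset.mem_univ i)
  nlinarith [sq_nonneg (f x)]

/-- The growth of the localized mass of a solution is bounded by the integral of any continuous
upper bound for its rate. -/
theorem IsSolution.localized_mass_sub_le {u : ℝ → H1} (hu : IsSolution u) {P : Fin 4 → ℝ → ℝ}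
    {B : ℝ} (hP : IsWeight P B) (a : ℝ) {t₁ t₂ : ℝ} (h0 : 0 ≤ t₁) (h12 : t₁ ≤ t₂) {b : ℝ → ℝ}
    (hb : Continuous b) (hrate : ∀ s ∈ Ioc t₁ t₂, ∃ g, HasWeakGrad (u s) g ∧
      massRate P (a - s / 2) (u s) (g 0) (g 1) (fun x => u s x ^ 3) ≤ b s) :
    (∫ x, u t₂ x * u t₂ x * P 0 (x 0 + (a - t₂ / 2)))
      - (∫ x, u t₁ x * u t₁ x * P 0 (x 0 + (a - t₁ / 2))) ≤ ∫ s in Ioc t₁ t₂, b s := by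
  let G : ℕ → ℝ → ℝ := fun n s => massRate P (a - s / 2) (mollify (molli n) (u s))
      (mollify (partialD 0 (molli n)) (u s)) (mollify (partialD 1 (molli n)) (u s))
      (mollify (molli n) fun x => u s x ^ 3)
  let L : ℝ → ℝ := fun s => massRate P (a - s / 2) (u s) (fun x => (u s).1.snd x 0)
    (fun x => (u s).1.snd x 1) (fun x => u s x ^ 3)
  have hW (s : ℝ) := H1.hasWeakGrad (u s)
  have hGL (s : ℝ) : Tendsto (fun n => G n s) atTop (𝓝 (L s)) :=
    (hW s).tendsto_massRate_mollify hP (a - s / 2)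
  have hG (n : ℕ) := hu.mollified_mass hP a h0 h12 (isTest_molli n)
  have hend (s : ℝ) : Tendsto (fun n => ∫ x, mollify (molli n) (u s) x * mollify (molli n) (u s) x
      * P 0 (x 0 + (a - s / 2))) atTop (𝓝 (∫ x, u s x * u s x * P 0 (x 0 + (a - s / 2)))) :=
    (tendstoL2_mollify (hW s).memLp).integral_mul_mul (tendstoL2_mollify (hW s).memLp)
      (hP.aestronglyMeasurable 0 _) fun x => hP.bound 0 _
  obtain ⟨R, hR0, hR⟩ := exists_uniform_bound hu.continuousOn h0 t₂
  -- Uniform in `n`: the differentiated kernel acts as the mollifier on the weak gradient, and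
  -- mollifiers are $L^2$ contractions.
  have hGb (n : ℕ) {s : ℝ} (hs : s ∈ Ioc t₁ t₂) : ‖G n s‖ ≤ 20 * (B * R) := by
    obtain ⟨r1, r2, r3⟩ := hR s ⟨hs.1.le, hs.2⟩
    have hn := isTest_molli n
    have hg (i : Fin 2) : ∫ x, mollify (partialD i (molli n)) (u s) x ^ 2 ≤ R := by
      rw [(hW s).mollify_partialD hn]
      refine (integral_mollify_molli_sq_le n ((hW s).memLp_grad i)).trans ?_
      exact ((hW s).integral_grad_le_energy i).trans ((H1.energy_eq (u s)).trans_le r1)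
    exact abs_massRate_le hP _ (memLp_mollify hn (hW s).memLp)
      (memLp_mollify (hn.isTest_partialD 0) (hW s).memLp)
      (memLp_mollify (hn.isTest_partialD 1) (hW s).memLp)
      (memLp_mollify hn ((hW s).memLp_pow 2))
      ((integral_mollify_molli_sq_le n (hW s).memLp).trans r2) (hg 0) (hg 1)
      ((integral_mollify_molli_sq_le n ((hW s).memLp_pow 2)).trans r3)
  have hmeas (n : ℕ) : AEStronglyMeasurable (G n) (volume.restrict (Ioc t₁ t₂)) := (hG n).1.1
  have hbd (n : ℕ) : ∀ᵐ s ∂volume.restrict (Ioc t₁ t₂), ‖G n s‖ ≤ 20 * (B * R) :=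
    (ae_restrict_iff' measurableSet_Ioc).2 (Eventually.of_forall fun s hs => hGb n hs)
  have hlim := tendsto_integral_of_dominated_convergence (fun _ => 20 * (B * R)) hmeas
    (integrable_const _) hbd (Eventually.of_forall hGL)
  have hLint : IntegrableOn L (Ioc t₁ t₂) := by
    refine Integrable.mono' (integrable_const (20 * (B * R)))
      (aestronglyMeasurable_of_tendsto_ae atTop hmeas (Eventually.of_forall hGL)) ?_
    refine (ae_restrict_iff' measurableSet_Ioc).2 (Eventually.of_forall fun s hs => ?_)
    exact le_of_tendsto' (hGL s).norm fun n => hGb n hs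
  have heq := tendsto_nhds_unique (((hend t₂).sub (hend t₁)).congr fun n => (hG n).2) hlim
  rw [heq]
  refine setIntegral_mono_on hLint (hb.integrableOn_Ioc) measurableSet_Ioc fun s hs => ?_
  obtain ⟨g, hg, hle⟩ := hrate s hs
  -- The rate for any weak gradient `g` is the limit of the same mollified rates, which do not
  -- involve the gradient, so it equals `L s`.
  rwa [tendsto_nhds_unique (hGL s) (hg.tendsto_massRate_mollify hP (a - s / 2))]

/-! ### The arctangent weight. -/

/-- The arctangent weight and its first three derivatives. -/
noncomputable def arctanWeight (M : ℝ) : Fin 4 → ℝ → ℝ :=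
  ![weight M, fun s => 1 / (Real.pi * M) * (Real.cosh (s / M))⁻¹,
    fun s => -(1 / (Real.pi * M) * (1 / M * (Real.sinh (s / M) / Real.cosh (s / M) ^ 2))),
    fun s => 1 / (Real.pi * M) * (1 / M ^ 2 * ((Real.cosh (s / M))⁻¹
      - 2 / Real.cosh (s / M) ^ 3))]

theorem arctanWeight_one (M s : ℝ) :
    arctanWeight M 1 s = 1 / (Real.pi * M) * (Real.cosh (s / M))⁻¹ := rfl

theorem arctanWeight_two (M s : ℝ) : arctanWeight M 2 s
    = -(1 / (Real.pi * M) * (1 / M * (Real.sinh (s / M) / Real.cosh (s / M) ^ 2))) := rfl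

theorem arctanWeight_three (M s : ℝ) : arctanWeight M 3 s
    = 1 / (Real.pi * M) * (1 / M ^ 2 * ((Real.cosh (s / M))⁻¹ - 2 / Real.cosh (s / M) ^ 3)) := rfl

theorem arctanWeight_one_pos {M : ℝ} (hM : 4 ≤ M) (s : ℝ) : 0 < arctanWeight M 1 s := by
  have := Real.cosh_pos (s / M)
  rw [arctanWeight_one]
  positivity

theorem one_div_pi_mul_le {M : ℝ} (hM : 4 ≤ M) : 1 / (Real.pi * M) ≤ 1 / 2 := by
  have h := Real.pi_gt_three
  exact one_div_le_one_div_of_le two_pos (by nlinarith)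

theorem arctanWeight_one_le_one {M : ℝ} (hM : 4 ≤ M) (s : ℝ) : arctanWeight M 1 s ≤ 1 := by
  have h1 : (Real.cosh (s / M))⁻¹ ≤ 1 := inv_le_one_of_one_le₀ (Real.one_le_cosh _)
  have h2 : 0 < (Real.cosh (s / M))⁻¹ := inv_pos.2 (Real.cosh_pos _)
  rw [arctanWeight_one]
  nlinarith [one_div_pi_mul_le hM]

theorem arctanWeight_one_le_exp {M : ℝ} (hM : 4 ≤ M) (s : ℝ) :
    arctanWeight M 1 s ≤ Real.exp (s / M) := by
  have h1 : (Real.cosh (s / M))⁻¹ ≤ 2 * Real.exp (s / M) := by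
    rw [inv_le_iff_one_le_mul₀ (Real.cosh_pos _), Real.cosh_eq]
    have : Real.exp (s / M) * Real.exp (-(s / M)) = 1 := by rw [← Real.exp_add]; simp
    nlinarith [Real.exp_pos (s / M)]
  have h2 : 0 < (Real.cosh (s / M))⁻¹ := inv_pos.2 (Real.cosh_pos _)
  rw [arctanWeight_one]
  nlinarith [one_div_pi_mul_le hM]

theorem abs_arctanWeight_two_le {M : ℝ} (hM : 4 ≤ M) (s : ℝ) :
    |arctanWeight M 2 s| ≤ arctanWeight M 1 s := by
  have hc := Real.cosh_pos (s / M)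
  have hs : |Real.sinh (s / M)| ≤ Real.cosh (s / M) := by
    refine abs_le_of_sq_le_sq ?_ hc.le
    rw [Real.cosh_sq]
    linarith
  have hM1 : 1 / M ≤ 1 := by rw [div_le_one (by linarith)]; linarith
  rw [arctanWeight_two, arctanWeight_one, abs_neg, abs_mul,
    abs_of_pos (by positivity : (0 : ℝ) < 1 / (Real.pi * M))]
  refine mul_le_mul_of_nonneg_left ?_ (by positivity)
  rw [abs_mul, abs_of_pos (by positivity : (0 : ℝ) < 1 / M), abs_div,
    abs_of_pos (by positivity : 0 < Real.cosh (s / M) ^ 2)]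
  calc 1 / M * (|Real.sinh (s / M)| / Real.cosh (s / M) ^ 2)
      ≤ 1 * (Real.cosh (s / M) / Real.cosh (s / M) ^ 2) := by gcongr
    _ = _ := by field_simp

/-- Up to a common factor the ratio is $M^{-2}(1-2\,\mathrm{sech}^2)$, at most $\frac1{16}$ in size
because $M\ge4$. This lets the drift term $-\frac12\int u^2\psi'$ absorb $\int u^2\psi'''$. -/
theorem abs_arctanWeight_three_le {M : ℝ} (hM : 4 ≤ M) (s : ℝ) :
    |arctanWeight M 3 s| ≤ 1 / 16 * arctanWeight M 1 s := by
  have hc := Real.cosh_pos (s / M)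
  have hc1 := Real.one_le_cosh (s / M)
  have hM1 : 1 / M ^ 2 ≤ 1 / 16 := one_div_le_one_div_of_le (by norm_num) (by nlinarith)
  have key : |(Real.cosh (s / M))⁻¹ - 2 / Real.cosh (s / M) ^ 3| ≤ (Real.cosh (s / M))⁻¹ := by
    have h1 : 2 / Real.cosh (s / M) ^ 3 ≤ 2 * (Real.cosh (s / M))⁻¹ := by
      rw [div_eq_mul_inv]
      gcongr
      exact le_self_pow₀ hc1 (by norm_num)
    have h2 : 0 < 2 / Real.cosh (s / M) ^ 3 := by positivity
    rw [abs_le]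
    constructor <;> linarith
  rw [arctanWeight_three, arctanWeight_one, abs_mul, abs_mul,
    abs_of_pos (by positivity : (0 : ℝ) < 1 / (Real.pi * M)),
    abs_of_pos (by positivity : (0 : ℝ) < 1 / M ^ 2)]
  calc 1 / (Real.pi * M) * (1 / M ^ 2 * |(Real.cosh (s / M))⁻¹ - 2 / Real.cosh (s / M) ^ 3|)
      ≤ 1 / (Real.pi * M) * (1 / 16 * (Real.cosh (s / M))⁻¹) := by gcongr
    _ = _ := by ring

theorem weight_nonneg (M s : ℝ) : 0 ≤ weight M s := by
  have : 0 ≤ Real.arctan (Real.exp (s / M)) := Real.arctan_nonneg.2 (Real.exp_pos _).le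
  rw [weight]
  positivity

theorem weight_le_one (M s : ℝ) : weight M s ≤ 1 := by
  rw [weight, div_mul_eq_mul_div, div_le_one Real.pi_pos]
  linarith [Real.arctan_lt_pi_div_two (Real.exp (s / M))]

theorem weight_monotone {M : ℝ} (hM : 4 ≤ M) : Monotone (weight M) := by
  intro s t h
  rw [weight, weight]
  have h0 : 0 < M := by linarith
  gcongr

theorem half_le_weight {M : ℝ} (hM : 4 ≤ M) {s : ℝ} (hs : 0 ≤ s) : 1 / 2 ≤ weight M s := by
  refine le_trans (le_of_eq ?_) (weight_monotone hM hs)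
  rw [weight, zero_div, Real.exp_zero, Real.arctan_one]
  field_simp
  norm_num

theorem weight_le_exp (M s : ℝ) : weight M s ≤ Real.exp (s / M) := by
  have h1 : Real.arctan (Real.exp (s / M)) ≤ Real.exp (s / M) :=
    (Real.lt_tan (Real.arctan_pos.2 (Real.exp_pos _)) (Real.arctan_lt_pi_div_two _)).le.trans_eq
      (Real.tan_arctan _)
  have h2 : 2 / Real.pi ≤ 1 := by
    rw [div_le_one Real.pi_pos]; linarith [Real.pi_gt_three]
  have h3 : 0 ≤ Real.arctan (Real.exp (s / M)) := Real.arctan_nonneg.2 (Real.exp_pos _).le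
  rw [weight]
  nlinarith

theorem hasDerivAt_cosh_div {M : ℝ} (s : ℝ) :
    HasDerivAt (fun s => Real.cosh (s / M)) (Real.sinh (s / M) * (1 / M)) s :=
  ((hasDerivAt_id s).div_const M).cosh

theorem hasDerivAt_sinh_div {M : ℝ} (s : ℝ) :
    HasDerivAt (fun s => Real.sinh (s / M)) (Real.cosh (s / M) * (1 / M)) s :=
  ((hasDerivAt_id s).div_const M).sinh

theorem isWeight_arctanWeight {M : ℝ} (hM : 4 ≤ M) : IsWeight (arctanWeight M) 1 := by
  have hM0 : M ≠ 0 := by linarith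
  have d0 (s : ℝ) : HasDerivAt (arctanWeight M 0) (arctanWeight M 1 s) s := by
    have h := (((hasDerivAt_id s).div_const M).exp.arctan).const_mul (2 / Real.pi)
    refine h.congr_deriv ?_
    rw [arctanWeight_one, Real.cosh_eq, Real.exp_neg]
    simp only [id]
    have := Real.exp_pos (s / M)
    have hpi := Real.pi_pos
    field_simp
    ring
  have d1 (s : ℝ) : HasDerivAt (arctanWeight M 1) (arctanWeight M 2 s) s := by
    have hc := (Real.cosh_pos (s / M)).ne'
    have h := ((hasDerivAt_cosh_div (M := M) s).fun_inv hc).const_mul (1 / (Real.pi * M))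
    refine h.congr_deriv ?_
    rw [arctanWeight_two]
    ring
  have d2 (s : ℝ) : HasDerivAt (arctanWeight M 2) (arctanWeight M 3 s) s := by
    have hc := (Real.cosh_pos (s / M)).ne'
    have h := ((((hasDerivAt_sinh_div (M := M) s).fun_div ((hasDerivAt_cosh_div (M := M) s).fun_pow 2)
      (pow_ne_zero 2 hc)).const_mul (1 / M)).const_mul (1 / (Real.pi * M))).fun_neg
    refine h.congr_deriv ?_
    rw [arctanWeight_three]
    have hs : Real.sinh (s / M) ^ 2 = Real.cosh (s / M) ^ 2 - 1 := by
      rw [Real.cosh_sq]; ring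
    have hpi := Real.pi_pos
    generalize Real.sinh (s / M) = S at *
    generalize Real.cosh (s / M) = C at *
    norm_num
    field_simp
    rw [hs]
    ring
  have d (i : Fin 3) (s : ℝ) :
      HasDerivAt (arctanWeight M i.castSucc) (arctanWeight M i.succ s) s := by
    fin_cases i
    · exact d0 s
    · exact d1 s
    · exact d2 s
  refine ⟨d, fun i => ?_, fun i s => ?_⟩
  · rcases Fin.eq_castSucc_or_eq_last i with ⟨j, rfl⟩ | rfl
    · exact continuous_iff_continuousAt.2 fun s => (d j s).continuousAt
    · have h0 (s : ℝ) : Real.cosh (s / M) ≠ 0 := (Real.cosh_pos _).ne'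
      have h3 (s : ℝ) : Real.cosh (s / M) ^ 3 ≠ 0 := pow_ne_zero 3 (h0 s)
      change Continuous fun s => 1 / (Real.pi * M) * (1 / M ^ 2 * ((Real.cosh (s / M))⁻¹
        - 2 / Real.cosh (s / M) ^ 3))
      fun_prop (disch := assumption)
  · have h1 := arctanWeight_one_le_one hM s
    have hp := arctanWeight_one_pos hM s
    fin_cases i
    · change |weight M s| ≤ 1
      rw [abs_of_nonneg (weight_nonneg M s)]
      exact weight_le_one M s
    · change |arctanWeight M 1 s| ≤ 1
      rwa [abs_of_pos hp]
    · exact (abs_arctanWeight_two_le hM s).trans h1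
    · exact (abs_arctanWeight_three_le hM s).trans (by linarith)

/-- The square root of the derivative of the arctangent weight is admissible in the weighted
Gagliardo-Nirenberg inequality. -/
theorem sqrt_arctanWeight {M : ℝ} (hM : 4 ≤ M) (c : ℝ) :
    ContDiff ℝ 1 (fun x : Plane => √(arctanWeight M 1 (x 0 + c))) ∧
      ∀ i x, |partialD i (fun x : Plane => √(arctanWeight M 1 (x 0 + c))) x|
        ≤ |√(arctanWeight M 1 (x 0 + c))| := by
  have hP := isWeight_arctanWeight hM
  have hpos := arctanWeight_one_pos hM
  have hcd : ContDiff ℝ 1 (fun x : Plane => √(arctanWeight M 1 (x 0 + c))) := by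
    refine ContDiff.sqrt ?_ fun x => (hpos _).ne'
    have h1 : ContDiff ℝ 1 (arctanWeight M 1) := by
      change ContDiff ℝ 1 fun s => 1 / (Real.pi * M) * (Real.cosh (s / M))⁻¹
      exact contDiff_const.mul ((Real.contDiff_cosh.comp (contDiff_id.div_const M)).inv
        fun s => (Real.cosh_pos _).ne')
    exact h1.comp (by fun_prop)
  refine ⟨hcd, fun i x => ?_⟩
  have hpd {v : ℝ} (h : HasLineDerivAt ℝ (fun x : Plane => √(arctanWeight M 1 (x 0 + c))) v x
      (EuclideanSpace.single i 1)) :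
      partialD i (fun x : Plane => √(arctanWeight M 1 (x 0 + c))) x = v := by
    rw [← h.lineDeriv, (hcd.differentiable one_ne_zero x).lineDeriv_eq_fderiv]
    rfl
  fin_cases i
  · have hd : HasDerivAt (fun s => √(arctanWeight M 1 s))
        (arctanWeight M 2 (x 0 + c) / (2 * √(arctanWeight M 1 (x 0 + c)))) (x 0 + c) :=
      (hP.hasDerivAt 1 (x 0 + c)).sqrt (hpos _).ne'
    have h := hpd (hasLineDerivAt_zero_of_hasDerivAt hd)
    change |partialD 0 _ x| ≤ _
    refine (congrArg abs h).trans_le ?_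
    have hw : 0 < √(arctanWeight M 1 (x 0 + c)) := Real.sqrt_pos.2 (hpos _)
    have hsq : √(arctanWeight M 1 (x 0 + c)) ^ 2 = arctanWeight M 1 (x 0 + c) :=
      Real.sq_sqrt (hpos _).le
    have h2 := abs_arctanWeight_two_le hM (x 0 + c)
    -- The derivative is $\psi''/(2\sqrt{\psi'})$, and $|\psi''|\le\psi'$ bounds it by
    -- $\frac12\sqrt{\psi'}$.
    rw [abs_div, abs_of_pos hw, abs_of_pos (by positivity : 0 < 2 * √(arctanWeight M 1 (x 0 + c))),
      div_le_iff₀ (by positivity)]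
    nlinarith
  · have h := hpd (hasLineDerivAt_one_comp (fun s => √(arctanWeight M 1 s)) c x)
    change |partialD 1 _ x| ≤ _
    refine (congrArg abs h).trans_le ?_
    simp

/-! ### Growth rate near the ground state. -/

theorem massRate_congr_ae {P : Fin 4 → ℝ → ℝ} (c : ℝ) {f f' a b : Plane → ℝ}
    (h : f =ᵐ[volume] f') :
    massRate P c f a b (fun x => f x ^ 3) = massRate P c f' a b fun x => f' x ^ 3 := by
  have e1 (i : Fin 4) : ∫ x, f x * f x * P i (x 0 + c) = ∫ x, f' x * f' x * P i (x 0 + c) :=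
    integral_congr_ae (by filter_upwards [h] with x hx; rw [hx])
  have e2 : ∫ x, a x * f x ^ 3 * P 0 (x 0 + c) = ∫ x, a x * f' x ^ 3 * P 0 (x 0 + c) :=
    integral_congr_ae (by filter_upwards [h] with x hx; rw [hx])
  have e3 : ∫ x, f x * f x ^ 3 * P 1 (x 0 + c) = ∫ x, f' x * f' x ^ 3 * P 1 (x 0 + c) :=
    integral_congr_ae (by filter_upwards [h] with x hx; rw [hx])
  simp only [massRate, e1, e2, e3]

theorem energy_add_le {a b : Plane → ℝ} {ga gb : Fin 2 → Plane → ℝ} (ha : HasWeakGrad a ga)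
    (hb : HasWeakGrad b gb) :
    energy (fun x => a x + b x) (fun i x => ga i x + gb i x) ≤
        2 * energy a ga + 2 * energy b gb := by
  simp only [energy]
  rw [← integral_const_mul, ← integral_const_mul,
    ← integral_add (ha.integrable_energy.const_mul 2) (hb.integrable_energy.const_mul 2)]
  refine integral_mono (ha.add hb).integrable_energy
    ((ha.integrable_energy.const_mul 2).add (hb.integrable_energy.const_mul 2)) fun x => ?_
  simp only [Fin.sum_univ_two]
  nlinarith [sq_nonneg (a x - b x), sq_nonneg (ga 0 x - gb 0 x), sq_nonneg (ga 1 x - gb 1 x)]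

theorem energy_translate (f : Plane → ℝ) (g : Fin 2 → Plane → ℝ) (y : Plane) :
    energy (fun x => f (x + y)) (fun i x => g i (x + y)) = energy f g :=
  integral_add_right_eq_self (fun x => f x ^ 2 + ∑ i, g i x ^ 2) y

/-- The quantity that controls the contribution of the bulk of the solitary wave. -/
noncomputable def bulk (p : Plane → ℝ) (x : Plane) : ℝ :=
  p x ^ 4 + (p x ^ 2 + ∑ i, partialD i p x ^ 2)

theorem bulk_nonneg (p : Plane → ℝ) (x : Plane) : 0 ≤ bulk p x := by
  unfold bulk; positivity

theorem IsTest.integrable_bulk {p : Plane → ℝ} (hp : IsTest p) : Integrable (bulk p) :=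
  (hp.pow four_ne_zero).integrable.add hp.hasWeakGrad.integrable_energy

/-- The growth rate of the localized mass of a function that is close to a test function `p`. -/
theorem exists_massRate_le : ∃ β : ℝ, 0 < β ∧ ∀ (p v f : Plane → ℝ) (gv : Fin 2 → Plane → ℝ)
    (M c : ℝ), IsTest p → HasWeakGrad v gv → energy v gv ≤ β → 4 ≤ M →
    (f =ᵐ[volume] fun x => v x + p x) → ∃ g, HasWeakGrad f g ∧
      massRate (arctanWeight M) c f (g 0) (g 1) (fun x => f x ^ 3)
        ≤ 12 * ∫ x, bulk p x * arctanWeight M 1 (x 0 + c) := by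
  obtain ⟨K, hK0, hK⟩ := exists_weighted_gagliardoNirenberg
  -- This choice makes the Gagliardo-Nirenberg constant times $\|v\|_2^2$ at most $\frac1{64}$.
  refine ⟨1 / (64 * K), by positivity, fun p v f gv M c hp hv hβ hM hf => ?_⟩
  have hP := isWeight_arctanWeight hM
  have hpw := hp.hasWeakGrad
  have hs := hv.add hpw
  refine ⟨fun i x => gv i x + partialD i p x, hs.congr hf.symm, ?_⟩
  rw [massRate_congr_ae c hf, massRate_eq hs hP]
  set P := arctanWeight M with hPdef
  have pos (x : Plane) : 0 < P 1 (x 0 + c) := arctanWeight_one_pos hM _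
  have bd {h : Plane → ℝ} (hh : Integrable h) : Integrable fun x => h x * P 1 (x 0 + c) :=
    hh.mul_bdd (hP.aestronglyMeasurable 1 c) (Eventually.of_forall fun x => hP.bound 1 _)
  have I {h : Plane → ℝ} (hh : MemLp h 2 volume) (i : Fin 4) := hP.integrable_mul i c hh hh
  have hF3 : ∫ x, (v x + p x) * (v x + p x) * P 3 (x 0 + c)
      ≤ 1 / 16 * ∫ x, (v x + p x) * (v x + p x) * P 1 (x 0 + c) := by
    rw [← integral_const_mul]
    refine integral_mono (I hs.memLp 3) ((I hs.memLp 1).const_mul _) fun x => ?_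
    dsimp only
    have h3 := (abs_le.1 (abs_arctanWeight_three_le hM (x 0 + c))).2
    nlinarith [mul_le_mul_of_nonneg_left h3 (mul_self_nonneg (v x + p x))]
  have i4 {h : Plane → ℝ} {g : Fin 2 → Plane → ℝ} (hh : HasWeakGrad h g) :
      Integrable fun x => h x ^ 4 :=
    (hh.memLp_pow 1).integrable_sq.congr (Eventually.of_forall fun x => by dsimp only; ring)
  have hN4 : ∫ x, (v x + p x) ^ 4 * P 1 (x 0 + c)
      ≤ 8 * (∫ x, v x ^ 4 * P 1 (x 0 + c)) + 8 * ∫ x, p x ^ 4 * P 1 (x 0 + c) := by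
    rw [← integral_const_mul, ← integral_const_mul, ← integral_add ((bd (i4 hv)).const_mul 8)
      ((bd (i4 hpw)).const_mul 8)]
    refine integral_mono (bd (i4 hs)) (((bd (i4 hv)).const_mul 8).add
      ((bd (i4 hpw)).const_mul 8)) fun x => ?_
    dsimp only
    have h4 : (v x + p x) ^ 4 ≤ 8 * v x ^ 4 + 8 * p x ^ 4 := by
      nlinarith [sq_nonneg (v x - p x), sq_nonneg (v x + p x), sq_nonneg (v x ^ 2 - p x ^ 2),
        mul_nonneg (sq_nonneg (v x - p x)) (sq_nonneg (v x + p x)), sq_nonneg ((v x - p x) ^ 2),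
        mul_nonneg (sq_nonneg (v x - p x)) (sq_nonneg (v x)),
        mul_nonneg (sq_nonneg (v x - p x)) (sq_nonneg (p x))]
    nlinarith [mul_le_mul_of_nonneg_right h4 (pos x).le]
  have hV4 : ∫ x, v x ^ 4 * P 1 (x 0 + c)
      ≤ 1 / 64 * ∫ x, (v x ^ 2 + ∑ i, gv i x ^ 2) * P 1 (x 0 + c) := by
    obtain ⟨w1, w2⟩ := sqrt_arctanWeight hM c
    have hsq (x : Plane) : √(P 1 (x 0 + c)) ^ 2 = P 1 (x 0 + c) := Real.sq_sqrt (pos x).le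
    have h := hK v gv _ 1 hv w1 w2 fun x => by
      rw [abs_of_nonneg (Real.sqrt_nonneg _), Real.sqrt_le_one]
      exact arctanWeight_one_le_one hM _
    rw [← hPdef] at h
    simp_rw [hsq] at h
    refine h.trans ?_
    refine mul_le_mul_of_nonneg_right ?_
        (integral_nonneg fun x => mul_nonneg (by positivity) (pos x).le)
    have := hv.integral_sq_le_energy.trans hβ
    calc K * ∫ x, v x ^ 2 ≤ K * (1 / (64 * K)) := by gcongr
      _ = 1 / 64 := by field_simp
  -- From $v=(v+p)-p$: the weighted energy of `v` is returned to that of the solution, on which the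
  -- rate is negative, and to that of `p`.
  have hexp : ∫ x, (v x ^ 2 + ∑ i, gv i x ^ 2) * P 1 (x 0 + c)
      ≤ 2 * ((∫ x, (v x + p x) * (v x + p x) * P 1 (x 0 + c))
        + (∫ x, (gv 0 x + partialD 0 p x) * (gv 0 x + partialD 0 p x) * P 1 (x 0 + c))
        + ∫ x, (gv 1 x + partialD 1 p x) * (gv 1 x + partialD 1 p x) * P 1 (x 0 + c))
        + 2 * ∫ x, (p x ^ 2 + ∑ i, partialD i p x ^ 2) * P 1 (x 0 + c) := by
    have j0 := I hs.memLp 1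
    have j1 := I (hs.memLp_grad 0) 1
    have j2 := I (hs.memLp_grad 1) 1
    have j3 := bd hpw.integrable_energy
    have j012 : Integrable fun x => 2 * ((v x + p x) * (v x + p x) * P 1 (x 0 + c)
        + (gv 0 x + partialD 0 p x) * (gv 0 x + partialD 0 p x) * P 1 (x 0 + c)
        + (gv 1 x + partialD 1 p x) * (gv 1 x + partialD 1 p x) * P 1 (x 0 + c)) :=
      ((j0.add j1).add j2).const_mul 2
    rw [← integral_add_add j0 j1 j2, ← integral_const_mul, ← integral_const_mul,
      ← integral_add j012 (j3.const_mul 2)]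
    refine integral_mono (bd hv.integrable_energy) (j012.add (j3.const_mul 2)) fun x => ?_
    dsimp only
    simp only [Fin.sum_univ_two]
    have hx : v x ^ 2 + (gv 0 x ^ 2 + gv 1 x ^ 2) ≤ 2 * ((v x + p x) * (v x + p x)
        + (gv 0 x + partialD 0 p x) * (gv 0 x + partialD 0 p x)
        + (gv 1 x + partialD 1 p x) * (gv 1 x + partialD 1 p x))
        + 2 * (p x ^ 2 + (partialD 0 p x ^ 2 + partialD 1 p x ^ 2)) := by
      nlinarith [sq_nonneg (v x + 2 * p x), sq_nonneg (gv 0 x + 2 * partialD 0 p x),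
        sq_nonneg (gv 1 x + 2 * partialD 1 p x)]
    refine (mul_le_mul_of_nonneg_right hx (pos x).le).trans_eq ?_
    ring
  have hbulk : ∫ x, bulk p x * P 1 (x 0 + c) = (∫ x, p x ^ 4 * P 1 (x 0 + c))
      + ∫ x, (p x ^ 2 + ∑ i, partialD i p x ^ 2) * P 1 (x 0 + c) := by
    rw [← integral_add (bd (i4 hpw)) (bd hpw.integrable_energy)]
    simp only [bulk, add_mul]
  have n0 : 0 ≤ ∫ x, (v x + p x) * (v x + p x) * P 1 (x 0 + c) :=
    integral_nonneg fun x => mul_nonneg (mul_self_nonneg _) (pos x).le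
  have n1 : 0 ≤ ∫ x, (gv 0 x + partialD 0 p x) * (gv 0 x + partialD 0 p x) * P 1 (x 0 + c) :=
    integral_nonneg fun x => mul_nonneg (mul_self_nonneg _) (pos x).le
  have n2 : 0 ≤ ∫ x, (gv 1 x + partialD 1 p x) * (gv 1 x + partialD 1 p x) * P 1 (x 0 + c) :=
    integral_nonneg fun x => mul_nonneg (mul_self_nonneg _) (pos x).le
  have n3 : 0 ≤ ∫ x, (p x ^ 2 + ∑ i, partialD i p x ^ 2) * P 1 (x 0 + c) :=
    integral_nonneg fun x => mul_nonneg (by positivity) (pos x).le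
  -- The quartic term costs $\frac32\cdot8\cdot\frac1{64}\cdot2=\frac38$ of each weighted square.
  -- This is below the gradient coefficients $3$ and $1$, and $\frac1{16}+\frac38<\frac12$.
  have key {F1 F3 E1 E2 N4 V4 Q4 V T : ℝ} (h1 : F3 ≤ 1 / 16 * F1) (h2 : N4 ≤ 8 * V4 + 8 * Q4)
      (h3 : V4 ≤ 1 / 64 * V) (h4 : V ≤ 2 * (F1 + E1 + E2) + 2 * T) (n0 : 0 ≤ F1) (n1 : 0 ≤ E1)
      (n2 : 0 ≤ E2) (n3 : 0 ≤ T) :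
      -3 * E1 - E2 + F3 + 3 / 2 * N4 - 1 / 2 * F1 ≤ 12 * (Q4 + T) := by linarith
  rw [hbulk]
  exact key hF3 hN4 hV4 hexp n0 n1 n2 n3

/-- On the support of `q` the first coordinate is at most `R`, where $\psi'(s)\le e^{s/M}$ gives the
bound. The constants do not depend on the translation or the weight. -/
theorem integral_bulk_translate_le {q : Plane → ℝ} (hq : IsTest q) : ∃ R : ℝ, 0 ≤ R ∧
    ∀ (y : Plane) (M c : ℝ), 4 ≤ M →
      ∫ x, bulk (fun x => q (x + -y)) x * arctanWeight M 1 (x 0 + c)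
        ≤ (∫ x, bulk q x) * Real.exp ((R + y 0 + c) / M) := by
  obtain ⟨R, hR⟩ := hq.2.isCompact.isBounded.subset_closedBall (0 : Plane)
  refine ⟨|R|, abs_nonneg R, fun y M c hM => ?_⟩
  have hP := isWeight_arctanWeight hM
  have htr : ∫ x, bulk (fun x => q (x + -y)) x * arctanWeight M 1 (x 0 + c)
      = ∫ x, bulk q x * arctanWeight M 1 (x 0 + (y 0 + c)) := by
    rw [← integral_add_right_eq_self _ y]
    refine integral_congr_ae (Eventually.of_forall fun x => ?_)
    simp [bulk, partialD_comp_add, add_assoc]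
  rw [htr, ← integral_mul_const]
  refine integral_mono (hq.integrable_bulk.mul_bdd (hP.aestronglyMeasurable 1 _)
    (Eventually.of_forall fun x => hP.bound 1 _)) (hq.integrable_bulk.mul_const _) fun x => ?_
  dsimp only
  by_cases hx : x ∈ tsupport q
  · refine mul_le_mul_of_nonneg_left ((arctanWeight_one_le_exp hM _).trans ?_) (bulk_nonneg q x)
    have h1 : ‖x‖ ≤ R := by simpa using hR hx
    have h2 : x 0 ≤ |R| :=
      (le_abs_self _).trans (((PiLp.norm_apply_le x 0).trans h1).trans (le_abs_self R))
    have hM0 : 0 < M := by linarith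
    exact Real.exp_le_exp.2 (div_le_div_of_nonneg_right (by linarith) hM0.le)
  · have hz : bulk q x = 0 := by
      have hd (i : Fin 2) : partialD i q x = 0 := by
        rw [partialD, image_eq_zero_of_notMem_tsupport fun h => hx (tsupport_fderiv_subset ℝ h)]
        simp
      simp [bulk, hd, image_eq_zero_of_notMem_tsupport hx]
    simp [hz]

/-- Solutions close to the translated ground state are close to a translated test function. -/
theorem IsGroundState.exists_decomposition {Q : Plane → ℝ} (hQ : IsGroundState Q) {β : ℝ}
    (hβ : 0 < β) : ∃ q : Plane → ℝ, IsTest q ∧ ∃ α₀ : ℝ, 0 < α₀ ∧ ∀ (w : H1) (y : Plane) (α : ℝ),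
      0 < α → α < α₀ → IsCloseAt Q w y α → ∃ v gv, HasWeakGrad v gv ∧ energy v gv ≤ β ∧
        w =ᵐ[volume] fun x => v x + q (x + -y) := by
  obtain ⟨vQ, hvQ⟩ := hQ.mem_H1
  have hw := H1.hasWeakGrad vQ
  obtain ⟨φ, hφ, hφf, hφg⟩ := hw.exists_isTest_tendsto
  have he : Tendsto (fun n => energy (fun x => vQ x - φ n x)
      (fun i x => vQ.1.snd x i - partialD i (φ n) x)) atTop (𝓝 0) := by
    have := tendsto_energy ((TendstoL2.const hw.memLp).sub hφf)
      (G := fun n i x => vQ.1.snd x i - partialD i (φ n) x)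
      (g := fun i x => vQ.1.snd x i - vQ.1.snd x i)
      fun i => (TendstoL2.const (hw.memLp_grad i)).sub (hφg i)
    simpa [energy] using this
  obtain ⟨n, hn⟩ := (he.eventually_lt_const (by positivity : 0 < β / 4)).exists
  -- Both errors, $Q$ minus the test function and $u$ minus the translated $Q$, have energy at most
  -- `β / 4`; the energy of a sum is at most twice the sum of the energies.
  refine ⟨φ n, hφ n, √β / 2, by positivity, fun w y α hα hα₀ ⟨v, hv, hvα⟩ => ?_⟩
  have hd := hw.sub (hφ n).hasWeakGrad
  have hv' := H1.hasWeakGrad v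
  have hsum := hv'.add hd
  refine ⟨_, _, hsum.translate (-y), ?_, ?_⟩
  · refine (energy_translate _ _ _).trans_le ((energy_add_le hv' hd).trans ?_)
    rw [H1.energy_eq v]
    have h1 : ‖v‖ ^ 2 ≤ (√β / 2) ^ 2 :=
      pow_le_pow_left₀ (norm_nonneg _) (hvα.trans hα₀.le) 2
    rw [div_pow, Real.sq_sqrt hβ.le] at h1
    linarith
  · have hqm := (measurePreserving_add_right volume (-y)).quasiMeasurePreserving
    filter_upwards [hqm.ae hv, hqm.ae hvQ] with x h1 h2
    rw [h1, h2]
    simp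

/-! ### Comparison of the localized mass with the decay of the data. -/

theorem measurePreserving_plane : ∃ e : ℝ × ℝ ≃ᵐ Plane, MeasurePreserving e ∧
    ∀ a b, e (a, b) = !₂[a, b] :=
  ⟨MeasurableEquiv.finTwoArrow.symm.trans (MeasurableEquiv.toLp 2 (Fin 2 → ℝ)),
    ((PiLp.volume_preserving_toLp (Fin 2))).comp (volume_preserving_finTwoArrow ℝ).symm,
    fun _ _ => rfl⟩

theorem integrable_exp_neg_mul_abs {b : ℝ} (hb : 0 < b) :
    Integrable fun a : ℝ => Real.exp (-b * |a|) := by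
  rw [← integrableOn_univ, ← Iic_union_Ioi (a := (0 : ℝ)), integrableOn_union]
  constructor
  · refine (integrableOn_exp_mul_Iic hb 0).congr_fun (fun a ha => ?_) measurableSet_Iic
    simp [abs_of_nonpos (mem_Iic.1 ha)]
  · refine (integrableOn_exp_mul_Ioi (neg_neg_of_pos hb) 0).congr_fun (fun a ha => ?_)
      measurableSet_Ioi
    simp [abs_of_pos (mem_Ioi.1 ha)]

theorem integral_exp_le {k t t₀ : ℝ} (hk : 0 < k) (ht : t ≤ t₀) :
    ∫ s in Ioc t t₀, Real.exp ((s - t₀) / k) ≤ k := by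
  rw [← intervalIntegral.integral_of_le ht]
  have hd (s : ℝ) : HasDerivAt (fun s => k * Real.exp ((s - t₀) / k))
      (Real.exp ((s - t₀) / k)) s := by
    have h1 := ((((hasDerivAt_id s).sub_const t₀).div_const k).exp).const_mul k
    refine h1.congr_deriv ?_
    simp only [id]
    field_simp
  rw [intervalIntegral.integral_eq_sub_of_hasDerivAt (fun s _ => hd s)
    ((by fun_prop : Continuous fun s => Real.exp ((s - t₀) / k)).intervalIntegrable _ _)]
  have := Real.exp_pos ((t - t₀) / k)
  simp
  positivity

/-- By Tonelli only the integral over `a` remains. There $\psi(a-x_0)\le e^{(a-x_0)/M}$, and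
$1/M\le\delta/2$ lets half of the decay $e^{-\delta|a|}$ absorb $e^{a/M}$ while the other half stays
integrable. -/
theorem integral_sq_mul_weight_le {f : Plane → ℝ} (hf : MemLp f 2 volume) {c δ M : ℝ}
    (hδ : 0 < δ) (hM : 4 ≤ M) (hδM : 2 / δ ≤ M) (hc : 0 ≤ c)
    (hdec : ∀ᵐ a : ℝ, ∫⁻ b : ℝ, ENNReal.ofReal (f !₂[a, b] ^ 2)
      ≤ ENNReal.ofReal (c * Real.exp (-δ * |a|))) (x₀ : ℝ) :
    ∫ x : Plane, f x ^ 2 * weight M (x 0 - x₀)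
      ≤ (c * ∫ a : ℝ, Real.exp (-(δ / 2) * |a|)) * Real.exp (-x₀ / M) := by
  have hM0 : 0 < M := by linarith
  have hint : Integrable fun a : ℝ => c * Real.exp (-(δ / 2) * |a|) * Real.exp (-x₀ / M) :=
    ((integrable_exp_neg_mul_abs (half_pos hδ)).const_mul c).mul_const _
  have hw : Measurable (weight M) := (weight_monotone hM).measurable
  have hwx : Measurable fun x : Plane => weight M (x 0 - x₀) := hw.comp (by fun_prop)
  have hpos (x : Plane) : 0 ≤ f x ^ 2 * weight M (x 0 - x₀) :=
    mul_nonneg (sq_nonneg _) (weight_nonneg _ _)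
  have hmeas : AEStronglyMeasurable (fun x : Plane => f x ^ 2 * weight M (x 0 - x₀)) volume :=
    (hf.aestronglyMeasurable.pow 2).mul hwx.aestronglyMeasurable
  rw [integral_eq_lintegral_of_nonneg_ae (Eventually.of_forall hpos) hmeas]
  refine ENNReal.toReal_le_of_le_ofReal (mul_nonneg (mul_nonneg hc
    (integral_nonneg fun a => (Real.exp_pos _).le)) (Real.exp_pos _).le) ?_
  rw [← integral_const_mul, ← integral_mul_const, ofReal_integral_eq_lintegral_ofReal hint
    (Eventually.of_forall fun a => by positivity)]
  obtain ⟨e, he, hab⟩ := measurePreserving_plane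
  rw [← he.lintegral_comp_emb e.measurableEmbedding, Measure.volume_eq_prod, lintegral_prod]
  · refine lintegral_mono_ae ?_
    filter_upwards [hdec] with a ha
    have h1 (b : ℝ) : ENNReal.ofReal (f (e (a, b)) ^ 2 * weight M (e (a, b) 0 - x₀))
        = ENNReal.ofReal (f !₂[a, b] ^ 2) * ENNReal.ofReal (weight M (a - x₀)) := by
      rw [hab, ENNReal.ofReal_mul (sq_nonneg _)]
      rfl
    simp_rw [h1]
    rw [lintegral_mul_const' _ _ ENNReal.ofReal_ne_top]
    refine (mul_le_mul_left ha _).trans ?_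
    rw [← ENNReal.ofReal_mul (by positivity)]
    refine ENNReal.ofReal_le_ofReal ?_
    rw [mul_assoc, mul_assoc]
    refine mul_le_mul_of_nonneg_left ((mul_le_mul_of_nonneg_left (weight_le_exp M _)
      (Real.exp_pos _).le).trans ?_) hc
    rw [← Real.exp_add, ← Real.exp_add]
    refine Real.exp_le_exp.2 ?_
    have h2 : 1 / M ≤ δ / 2 := by
      rw [div_le_div_iff₀ hM0 two_pos]
      rw [div_le_iff₀ hδ] at hδM
      linarith
    have h3 : a / M ≤ δ / 2 * |a| := by
      calc a / M ≤ |a| / M := by gcongr; exact le_abs_self a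
        _ = 1 / M * |a| := by ring
        _ ≤ δ / 2 * |a| := by gcongr
    rw [sub_div, neg_div]
    linarith
  · exact (hmeas.aemeasurable.ennreal_ofReal.comp_quasiMeasurePreserving he.quasiMeasurePreserving)

/-- The weight is at least $\frac12$ on the right of its transition, whence the factor `2`. -/
theorem setIntegral_sq_le {f : Plane → ℝ} (hf : MemLp f 2 volume) {M : ℝ} (hM : 4 ≤ M)
    (y : Plane) (x₀ : ℝ) :
    ∫ x in {x : Plane | x₀ < x 0}, f (x + y) ^ 2
      ≤ 2 * ∫ x : Plane, f x ^ 2 * weight M (x 0 - y 0 - x₀) := by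
  have hw : Measurable (weight M) := (weight_monotone hM).measurable
  have hs : MeasurableSet {x : Plane | x₀ < x 0} := measurableSet_lt (by fun_prop) (by fun_prop)
  have hwx : Measurable fun x : Plane => weight M (x 0 - x₀) := hw.comp (by fun_prop)
  have hi : Integrable fun x => f (x + y) ^ 2 := (memLp_translate hf y).integrable_sq
  rw [← integral_add_right_eq_self (fun x : Plane => f x ^ 2 * weight M (x 0 - y 0 - x₀)) y,
    ← integral_const_mul, ← integral_indicator hs]
  simp only [PiLp.add_apply, add_sub_cancel_right]
  refine integral_mono (hi.indicator hs) ((hi.mul_bdd (c := 1) hwx.aestronglyMeasurable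
    (Eventually.of_forall fun x => ?_)).const_mul 2) fun x => ?_
  · rw [Real.norm_of_nonneg (weight_nonneg _ _)]
    exact weight_le_one _ _
  · by_cases hx : x ∈ {x : Plane | x₀ < x 0}
    · rw [indicator_of_mem hx]
      have := half_le_weight hM (sub_nonneg.2 (le_of_lt hx))
      nlinarith [mul_le_mul_of_nonneg_left this (sq_nonneg (f (x + y)))]
    · rw [indicator_of_notMem hx]
      exact mul_nonneg two_pos.le (mul_nonneg (sq_nonneg _) (weight_nonneg _ _))

/-! ### Almost monotonicity and decay on the right. -/

theorem IsGroundState.exists_almost_monotone {Q : Plane → ℝ} (hQ : IsGroundState Q) :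
    ∃ α₀ : ℝ, 0 < α₀ ∧ ∀ M : ℝ, 4 ≤ M → ∃ θ : ℝ, 0 < θ ∧
      ∀ (X : ℝ → Plane) (u : ℝ → H1) (α : ℝ), IsRightMoving X → IsSolution u → 0 < α → α < α₀ →
        (∀ t : ℝ, 0 ≤ t → IsCloseAt Q (u t) (X t) α) →
        ∀ x₀ t₀ t : ℝ, 0 ≤ t → t ≤ t₀ →
          localizedMass M u X x₀ t₀ t₀ - localizedMass M u X x₀ t₀ t
            ≤ θ * Real.exp (-x₀ / M) := by
  obtain ⟨β, hβ, hrate⟩ := exists_massRate_le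
  obtain ⟨q, hq, α₀, hα₀, hdec⟩ := hQ.exists_decomposition hβ
  obtain ⟨R, hR, hbulk⟩ := integral_bulk_translate_le hq
  have hN : 0 ≤ ∫ x, bulk q x := integral_nonneg fun x => bulk_nonneg q x
  -- The factor `4 * M` bounds the time integral of $e^{(s-t_0)/(4M)}$, and the final `1` only
  -- secures positivity.
  refine ⟨α₀, hα₀, fun M hM => ⟨12 * (∫ x, bulk q x) * Real.exp (R / M) * (4 * M) + 1,
      by positivity,
    fun X u α hX hu hα hαα₀ hclose x₀ t₀ t ht htt₀ => ?_⟩⟩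
  have hM0 : 0 < M := by linarith
  have hI (s : ℝ) : localizedMass M u X x₀ t₀ s = ∫ x, u s x * u s x *
      arctanWeight M 0 (x 0 + ((-X t₀ 0 + t₀ / 2 - x₀) - s / 2)) := by
    refine integral_congr_ae (Eventually.of_forall fun x => ?_)
    change u s x ^ 2 * weight M _ = u s x * u s x * weight M _
    rw [sq]
    congr 2
    ring
  have h := hu.localized_mass_sub_le (isWeight_arctanWeight hM) (-X t₀ 0 + t₀ / 2 - x₀) ht htt₀
    (b := fun s => 12 * (∫ x, bulk q x) * Real.exp (R / M) * Real.exp (-x₀ / M)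
      * Real.exp ((s - t₀) / (4 * M))) (by fun_prop) fun s hs => ?_
  · rw [hI, hI]
    refine h.trans ?_
    rw [integral_const_mul]
    have h1 := integral_exp_le (by positivity : 0 < 4 * M) htt₀
    have h2 := Real.exp_pos (-x₀ / M)
    calc _ ≤ 12 * (∫ x, bulk q x) * Real.exp (R / M) * Real.exp (-x₀ / M) * (4 * M) := by gcongr
      _ ≤ _ := by linarith
  · have hs0 : 0 ≤ s := ht.trans hs.1.le
    obtain ⟨v, gv, hv, hvβ, hw⟩ := hdec (u s) (X s) α hα hαα₀ (hclose s hs0)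
    obtain ⟨g, hg, hgle⟩ := hrate _ v (u s) gv M (-X t₀ 0 + t₀ / 2 - x₀ - s / 2)
      (hq.translate (-X s)) hv hvβ hM hw
    refine ⟨g, hg, hgle.trans ?_⟩
    -- The excess of speed $\frac34-\frac12=\frac14$ is the source of the factor $e^{(s-t_0)/(4M)}$.
    have hsp := hX.speed t₀ s hs0 hs.2
    have he : Real.exp ((R + X s 0 + (-X t₀ 0 + t₀ / 2 - x₀ - s / 2)) / M)
        ≤ Real.exp (R / M) * Real.exp (-x₀ / M) * Real.exp ((s - t₀) / (4 * M)) := by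
      rw [← Real.exp_add, ← Real.exp_add, Real.exp_le_exp]
      have : R / M + -x₀ / M + (s - t₀) / (4 * M) = (R - x₀ + (s - t₀) / 4) / M := by
        field_simp
        ring
      rw [this]
      exact div_le_div_of_nonneg_right (by linarith) hM0.le
    calc _ ≤ 12 * ((∫ x, bulk q x) *
          (Real.exp (R / M) * Real.exp (-x₀ / M) * Real.exp ((s - t₀) / (4 * M)))) := by
          refine mul_le_mul_of_nonneg_left ((hbulk _ _ _ hM).trans ?_) (by norm_num)
          gcongr
      _ = _ := by ring

/-- The transition starts at $x_1(t)-\frac t2+x_0\ge x_0$, and the weight is monotone. -/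
theorem localizedMass_zero_le {u : ℝ → H1} {X : ℝ → Plane} {M t : ℝ} (hM : 4 ≤ M)
    (hX : 1 / 2 * t ≤ X t 0) (x₀ : ℝ) :
    localizedMass M u X x₀ t 0 ≤ ∫ x, u 0 x ^ 2 * weight M (x 0 - x₀) := by
  have hi : Integrable fun x => u 0 x ^ 2 := (H1.hasWeakGrad (u 0)).memLp.integrable_sq
  have hw (c : Plane → ℝ) (hc : Measurable c) : Integrable fun x => u 0 x ^ 2 * weight M (c x) :=
    hi.mul_bdd (c := 1) ((weight_monotone hM).measurable.comp hc).aestronglyMeasurable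
      (Eventually.of_forall fun x => by
        rw [Real.norm_of_nonneg (weight_nonneg _ _)]
        exact weight_le_one _ _)
  refine integral_mono (hw _ (by fun_prop)) (hw _ (by fun_prop)) fun x =>
    mul_le_mul_of_nonneg_left (weight_monotone hM (by linarith)) (sq_nonneg _)

end ZK

theorem lemma7p1 (Q : ZK.Plane → ℝ) (hQ : ZK.IsGroundState Q) :
    ∃ α₀ : ℝ, 0 < α₀ ∧
      -- almost monotonicity
      (∀ M : ℝ, 4 ≤ M → ∃ θ : ℝ, 0 < θ ∧
        ∀ (X : ℝ → ZK.Plane) (u : ℝ → ZK.H1) (α : ℝ),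
          ZK.IsRightMoving X → ZK.IsSolution u → 0 < α → α < α₀ →
          (∀ t : ℝ, 0 ≤ t → ZK.IsCloseAt Q (u t) (X t) α) →
          ∀ x₀ t₀ t : ℝ, 0 < x₀ → 0 ≤ t → t ≤ t₀ →
            ZK.localizedMass M u X x₀ t₀ t₀ - ZK.localizedMass M u X x₀ t₀ t
              ≤ θ * Real.exp (-x₀ / M)) ∧
      -- exponential decay of the mass on the right
      (∀ c δ M : ℝ, 0 < c → 0 < δ → max 4 (2 / δ) ≤ M → ∃ C : ℝ, 0 < C ∧
        ∀ (X : ℝ → ZK.Plane) (u : ℝ → ZK.H1) (α : ℝ),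
          ZK.IsRightMoving X →
          (∀ t : ℝ, 0 ≤ t → 1 / 2 * t ≤ X t 0 ∧ X t 1 = 0) →
          ZK.IsSolution u → 0 < α → α < α₀ →
          (∀ t : ℝ, 0 ≤ t → ZK.IsCloseAt Q (u t) (X t) α) →
          (∀ᵐ a : ℝ, ∫⁻ b : ℝ, ENNReal.ofReal (u 0 !₂[a, b] ^ 2)
            ≤ ENNReal.ofReal (c * Real.exp (-δ * |a|))) →
          ∀ t x₀ : ℝ, 0 ≤ t → 0 < x₀ →
            ∫ y in {y : ZK.Plane | x₀ < y 0}, u t (y + !₂[X t 0, 0]) ^ 2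
              ≤ C * Real.exp (-x₀ / M)) := by
  obtain ⟨α₀, hα₀, hmono⟩ := hQ.exists_almost_monotone
  refine ⟨α₀, hα₀, fun M hM => ?_, fun c δ M hc hδ hMδ => ?_⟩
  · obtain ⟨θ, hθ, h⟩ := hmono M hM
    exact ⟨θ, hθ, fun X u α hX hu hα hαα₀ hcl x₀ t₀ t _ => h X u α hX hu hα hαα₀ hcl x₀ t₀ t⟩
  · obtain ⟨hM, hδM⟩ := max_le_iff.1 hMδ
    obtain ⟨θ, hθ, h⟩ := hmono M hM
    have hD : 0 ≤ c * ∫ a : ℝ, Real.exp (-(δ / 2) * |a|) :=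
      mul_nonneg hc.le (integral_nonneg fun a => (Real.exp_pos _).le)
    -- The factor `2` undoes $\psi\ge\frac12$; `θ` is the possible growth between times `0` and `t`,
    -- the other summand the localized mass of the initial datum.
    refine ⟨2 * (θ + c * ∫ a : ℝ, Real.exp (-(δ / 2) * |a|)), by positivity,
      fun X u α hX hX' hu hα hαα₀ hcl hdec t x₀ ht _ => ?_⟩
    have h1 := ZK.setIntegral_sq_le (ZK.H1.hasWeakGrad (u t)).memLp hM !₂[X t 0, 0] x₀
    have h2 := h X u α hX hu hα hαα₀ hcl x₀ t 0 le_rfl ht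
    have h3 := ZK.localizedMass_zero_le (u := u) hM (hX' t ht).1 x₀
    have h4 := ZK.integral_sq_mul_weight_le (ZK.H1.hasWeakGrad (u 0)).memLp hδ hM hδM hc.le hdec x₀
    have h5 : ZK.localizedMass M u X x₀ t t
        = ∫ x : ZK.Plane, u t x ^ 2 * ZK.weight M (x 0 - !₂[X t 0, 0] 0 - x₀) := by
      simp [ZK.localizedMass]
    rw [← h5] at h1
    linarith
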